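/- A connected simplicial graph is *median* if for all vertices $v_1,v_2,v_3$ there is a unique vertex $\mu$ with $d(v_i,v_j)=d(v_i,\mu)+d(\mu,v_j)$ for all $i\neq j$. A *CAT(0) cube complex* is the cell complex $X$ obtained from a median graph by attaching a unit cube $[0,1]^n$ to every subgraph isometric to a Cartesian product of $n$ edges, for every $n\ge 2$ (with the obvious identifications along faces). It is *finite-dimensional* if the dimensions of its cubes are bounded. It is equipped with its CAT(0) metric, that is, the length metric $d_2$ obtained by giving every cube the Euclidean metric. A map $f:A\to B$ of metric spaces is a *quasiisometry* if for some $q\ge1$ one has $\frac1q d(a,a')-q\le d(f(a),f(a'))\le q\,d(a,a')+q$ for all $a,a'\in A$, and every point of $B$ is within distance $q$ of $f(A)$; two spaces are *quasiisometric* if there is a quasiisometry between them. Let $X$ be a finite-dimensional CAT(0) cube complex (not necessarily proper or locally finite). 1. If $X$ is quasiisometric to $\mathbb{R}$, then $X$ contains a biinfinite CAT(0) geodesic, i.e. there is an isometric embedding $\mathbb{R}\to(X,d_2)$. 2. If $X$ is quasiisometric to $[0,\infty)\subset\mathbb{R}$, then $X$ contains a CAT(0) geodesic ray, i.e. there is an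 isometric embedding $[0,\infty)\to(X,d_2)$. -/

import Mathlib

/-- A simplicial graph is *median* if it is connected and any three vertices `u, v, w` have a unique
median, i.e. a vertex `m` lying on a geodesic between any two of them. -/
class IsMedianGraph {V : Type*} (G : SimpleGraph V) : Prop where
  connected : G.Connected
  existsUnique_median : ∀ u v w : V, ∃! m : V,
    G.dist u v = G.dist u m + G.dist m v ∧
    G.dist v w = G.dist v m + G.dist m w ∧
    G.dist u w = G.dist u m + G.dist m w

/-- `c` parametrises the vertices of an `n`-cube of `G`: it is an isometric embedding of the
product of `n` edges (the vertex set `{0,1}ⁿ` with the Hamming distance) into `G`.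
For `n = 0, 1` these are the vertices and the edges of `G`. -/
def IsGraphCube {V : Type*} (G : SimpleGraph V) {n : ℕ} (c : (Fin n → Bool) → V) : Prop :=
  ∀ a b, G.dist (c a) (c b) = hammingDist a b

/-- The unit cube `[0,1]ⁿ` in Euclidean space. -/
def unitCube (n : ℕ) : Set (EuclideanSpace ℝ (Fin n)) :=
  {s | ∀ i, s i ∈ Set.Icc (0 : ℝ) 1}

/-- The point with coordinates `s ∈ [0,1]ⁿ` in the cube with vertices `c a`, `a ∈ {0,1}ⁿ`.
The vertices of the graph are the standard basis of `ℝ^(V)`, and the cube is the image of `[0,1]ⁿ`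
under the multilinear interpolation of its vertices (so the `v`-coordinate of the point is
its weight at the vertex `v`). This is injective on each cube, and it is compatible with passing
to faces and with the symmetries of the cube; points of two cubes have the same image
exactly when they are the same point of a common face. -/
noncomputable def cubePoint {V : Type*} {n : ℕ} (c : (Fin n → Bool) → V)
    (s : EuclideanSpace ℝ (Fin n)) : V →₀ ℝ :=
  ∑ a : Fin n → Bool, Finsupp.single (c a) (∏ i, if a i then s i else 1 - s i)

/-- The (underlying set of the) cube complex obtained from the graph `G` by attaching a unit cube to
every subgraph isometric to a product of edges. For a median graph `G` this is
the CAT(0) cube complex with 1-skeleton `G`. -/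
def CubeComplex {V : Type*} (G : SimpleGraph V) : Type _ :=
  {x : V →₀ ℝ // ∃ (n : ℕ) (c : (Fin n → Bool) → V) (s : EuclideanSpace ℝ (Fin n)),
    IsGraphCube G c ∧ s ∈ unitCube n ∧ x = cubePoint c s}

/-- The cube complex has finite dimension: the dimensions of its cubes are bounded. -/
def CubeComplex.FiniteDimensional {V : Type*} (G : SimpleGraph V) : Prop :=
  ∃ N : ℕ, ∀ (n : ℕ) (c : (Fin n → Bool) → V), IsGraphCube G c → n ≤ N

namespace CubeComplex

/-- `x` and `y` lie in a common cube, with Euclidean distance `r` there. -/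
def InCubeAtDist {V : Type*} (G : SimpleGraph V) (x y : CubeComplex G) (r : ℝ) : Prop :=
  ∃ (n : ℕ) (c : (Fin n → Bool) → V) (s t : EuclideanSpace ℝ (Fin n)),
    IsGraphCube G c ∧ s ∈ unitCube n ∧ t ∈ unitCube n ∧
    x.1 = cubePoint c s ∧ y.1 = cubePoint c t ∧ r = dist s t

/-- `x` and `y` are joined by a piecewise linear path of length `ℓ`: a finite sequence of
points from `x` to `y`, consecutive ones lying in a common cube, whose Euclidean
distances in these cubes add up to `ℓ`. -/
inductive PathOfLength {V : Type*} (G : SimpleGraph V) :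
    CubeComplex G → CubeComplex G → ℝ → Prop
  | refl (x : CubeComplex G) : PathOfLength G x x 0
  | snoc {x y z : CubeComplex G} {ℓ r : ℝ} :
      PathOfLength G x y ℓ → InCubeAtDist G y z r → PathOfLength G x z (ℓ + r)

/-- The length metric `d₂` induced by the Euclidean (`ℓ²`) metrics on the cubes. -/
noncomputable def pathDist {V : Type*} (G : SimpleGraph V) (x y : CubeComplex G) : ℝ :=
  sInf {ℓ : ℝ | PathOfLength G x y ℓ}

section
variable {V : Type*} {G : SimpleGraph V}

theorem InCubeAtDist.symm {x y : CubeComplex G} {r : ℝ} (h : InCubeAtDist G x y r) :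
    InCubeAtDist G y x r := by
  obtain ⟨n, c, s, t, hc, hs, ht, hx, hy, rfl⟩ := h
  exact ⟨n, c, t, s, hc, ht, hs, hy, hx, dist_comm _ _⟩

theorem PathOfLength.nonneg {x y : CubeComplex G} {ℓ : ℝ} (h : PathOfLength G x y ℓ) :
    0 ≤ ℓ := by
  induction h with
  | refl => exact le_rfl
  | snoc _ h ih =>
    obtain ⟨n, c, s, t, -, -, -, -, -, rfl⟩ := h
    exact add_nonneg ih dist_nonneg

theorem PathOfLength.trans {x y z : CubeComplex G} {ℓ r : ℝ} (h : PathOfLength G x y ℓ)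
    (h' : PathOfLength G y z r) : PathOfLength G x z (ℓ + r) := by
  induction h' with
  | refl => simpa using h
  | snoc _ h₂ ih => rw [← add_assoc]; exact ih.snoc h₂

theorem InCubeAtDist.path {x y : CubeComplex G} {r : ℝ} (h : InCubeAtDist G x y r) :
    PathOfLength G x y r := by
  simpa using (PathOfLength.refl x).snoc h

theorem PathOfLength.symm {x y : CubeComplex G} {ℓ : ℝ} (h : PathOfLength G x y ℓ) :
    PathOfLength G y x ℓ := by
  induction h with
  | refl => exact .refl _
  | snoc _ h ih => rw [add_comm]; exact h.symm.path.trans ih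

theorem bddBelow_pathLengths (x y : CubeComplex G) :
    BddBelow {ℓ : ℝ | PathOfLength G x y ℓ} :=
  ⟨0, fun _ h => PathOfLength.nonneg h⟩

/-- The corner of the unit cube given by `a ∈ {0,1}ⁿ`. -/
noncomputable def corner {n : ℕ} (a : Fin n → Bool) : EuclideanSpace ℝ (Fin n) :=
  WithLp.toLp 2 fun i => if a i then 1 else 0

theorem corner_mem {n : ℕ} (a : Fin n → Bool) : corner a ∈ unitCube n := by
  intro i
  by_cases h : a i <;> simp [corner, h]

theorem cubePoint_corner {n : ℕ} (c : (Fin n → Bool) → V) (a : Fin n → Bool) :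
    cubePoint c (corner a) = Finsupp.single (c a) 1 := by
  unfold cubePoint
  rw [Finset.sum_eq_single a]
  · congr 1
    refine Finset.prod_eq_one fun i _ => ?_
    by_cases h : a i <;> simp [corner, h]
  · intro b _ hb
    obtain ⟨i, hi⟩ := Function.ne_iff.mp hb
    rw [Finset.prod_eq_zero (Finset.mem_univ i), Finsupp.single_zero]
    cases h : a i <;> cases h' : b i <;> simp_all [corner]
  · simp

/-- The vertices of the graph, as points of the complex. -/
noncomputable def vertex (G : SimpleGraph V) (v : V) : CubeComplex G :=
  ⟨Finsupp.single v 1, 0, fun _ => v, corner ![],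
    fun a b => by simp [Subsingleton.elim a b], corner_mem _,
    (cubePoint_corner (fun _ : Fin 0 → Bool => v) ![]).symm⟩

theorem exists_path_vertex (x : CubeComplex G) : ∃ v ℓ, PathOfLength G x (vertex G v) ℓ := by
  obtain ⟨x, n, c, s, hc, hs, rfl⟩ := x
  refine ⟨c fun _ => false, _, InCubeAtDist.path
    ⟨n, c, s, corner fun _ => false, hc, hs, corner_mem _, rfl, ?_, rfl⟩⟩
  rw [cubePoint_corner]; rfl

theorem exists_path_of_adj {u v : V} (h : G.Adj u v) :
    ∃ ℓ, PathOfLength G (vertex G u) (vertex G v) ℓ := by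
  refine ⟨_, InCubeAtDist.path ⟨1, fun a => if a 0 then v else u, corner fun _ => false,
    corner fun _ => true, ?_, corner_mem _, corner_mem _, ?_, ?_, rfl⟩⟩
  · have h1 : G.dist u v = 1 := SimpleGraph.dist_eq_one_iff_adj.mpr h
    have h2 : G.dist v u = 1 := SimpleGraph.dist_eq_one_iff_adj.mpr h.symm
    intro a b
    cases ha : a 0 <;> cases hb : b 0 <;> 
      simp [hammingDist, Finset.filter_singleton, ha, hb, h1, h2]
  · rw [cubePoint_corner]; simp [vertex]
  · rw [cubePoint_corner]; simp [vertex]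

theorem exists_path (hG : G.Connected) (x y : CubeComplex G) : ∃ ℓ, PathOfLength G x y ℓ := by
  obtain ⟨u, l₁, h₁⟩ := exists_path_vertex x
  obtain ⟨v, l₂, h₂⟩ := exists_path_vertex y
  have key : ∀ {u v : V}, G.Walk u v → ∃ ℓ, PathOfLength G (vertex G u) (vertex G v) ℓ := by
    intro u v p
    induction p with
    | nil => exact ⟨_, .refl _⟩
    | cons h _ ih =>
      obtain ⟨l, hl⟩ := ih
      obtain ⟨l', hl'⟩ := exists_path_of_adj h
      exact ⟨_, hl'.trans hl⟩
  obtain ⟨p⟩ := hG.preconnected u v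
  obtain ⟨l, hl⟩ := key p
  exact ⟨_, (h₁.trans hl).trans h₂.symm⟩

end

/-- The CAT(0) cube complex of a median graph, with the length metric `d₂`. -/
noncomputable instance {V : Type*} (G : SimpleGraph V) [IsMedianGraph G] :
    PseudoMetricSpace (CubeComplex G) where
  dist := pathDist G
  dist_self x := le_antisymm (csInf_le (bddBelow_pathLengths x x) (.refl x))
    (Real.sInf_nonneg fun _ h => PathOfLength.nonneg h)
  dist_comm x y := congrArg sInf (Set.ext fun _ => ⟨.symm, .symm⟩)
  dist_triangle x y z := by
    have hG : G.Connected := IsMedianGraph.connected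
    refine le_of_forall_pos_le_add fun ε hε => ?_
    obtain ⟨l, hl, hl'⟩ := exists_lt_of_csInf_lt (exists_path hG x y)
      (lt_add_of_pos_right (pathDist G x y) (half_pos hε))
    obtain ⟨r, hr, hr'⟩ := exists_lt_of_csInf_lt (exists_path hG y z)
      (lt_add_of_pos_right (pathDist G y z) (half_pos hε))
    have := csInf_le (bddBelow_pathLengths x z) (hl.trans hr)
    change pathDist G x z ≤ pathDist G x y + pathDist G y z + ε
    unfold pathDist at *
    linarith

/-- In finite dimension (the only case used below) `d₂` separates points, so it is a metric. -/
theorem eq_of_dist_eq_zero {V : Type*} {G : SimpleGraph V} [IsMedianGraph G]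
    (hdim : FiniteDimensional G) {x y : CubeComplex G} (h : dist x y = 0) : x = y := by
  obtain ⟨N, hN⟩ := hdim
  have hprod : ∀ {n : ℕ} (f g : Fin n → ℝ), (∀ i, |f i| ≤ 1) → (∀ i, |g i| ≤ 1) →
      |∏ i, f i - ∏ i, g i| ≤ ∑ i, |f i - g i| := by
    intro n f g hf hg
    induction n with
    | zero => simp
    | succ n ih =>
      rw [Fin.prod_univ_succ, Fin.prod_univ_succ, Fin.sum_univ_succ]
      have h1 := ih (fun i => f i.succ) (fun i => g i.succ) (fun i => hf _) (fun i => hg _)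
      have h2 : |∏ i : Fin n, g i.succ| ≤ 1 := by
        rw [Finset.abs_prod]
        exact Finset.prod_le_one (fun _ _ => abs_nonneg _) fun i _ => hg _
      calc |f 0 * ∏ i : Fin n, f i.succ - g 0 * ∏ i : Fin n, g i.succ|
          = |(f 0 - g 0) * ∏ i : Fin n, g i.succ
              + f 0 * (∏ i : Fin n, f i.succ - ∏ i : Fin n, g i.succ)| := by ring_nf
        _ ≤ |f 0 - g 0| * 1 + 1 * ∑ i : Fin n, |f i.succ - g i.succ| := by
            refine (abs_add_le _ _).trans (add_le_add ?_ ?_) <;> rw [abs_mul]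
            · exact mul_le_mul_of_nonneg_left h2 (abs_nonneg _)
            · exact mul_le_mul (hf 0) h1 (abs_nonneg _) zero_le_one
        _ = _ := by ring
  have hstep : ∀ {x y : CubeComplex G} {r : ℝ}, InCubeAtDist G x y r →
      ∀ v, |x.1 v - y.1 v| ≤ 2 ^ N * N * r := by
    rintro x y r ⟨n, c, s, t, hc, hs, ht, hx, hy, rfl⟩ v
    have hn : n ≤ N := hN n c hc
    rw [hx, hy]
    unfold cubePoint
    rw [Finsupp.finsetSum_apply, Finsupp.finsetSum_apply, ← Finset.sum_sub_distrib]
    have hc' : ∀ {s : EuclideanSpace ℝ (Fin n)}, s ∈ unitCube n → ∀ (a : Fin n → Bool) (i : Fin n),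
        |if a i then s i else 1 - s i| ≤ 1 := by
      intro s hs a i
      have := hs i
      simp only [Set.mem_Icc] at this
      split_ifs <;> rw [abs_le] <;> constructor <;> linarith
    have hterm : ∀ a : Fin n → Bool,
        |Finsupp.single (c a) (∏ i, if a i then s i else 1 - s i) v
          - Finsupp.single (c a) (∏ i, if a i then t i else 1 - t i) v| ≤ n * dist s t := by
      intro a
      have hd : |(∏ i, if a i then s i else 1 - s i) - ∏ i, if a i then t i else 1 - t i|
          ≤ n * dist s t := by
        refine (hprod _ _ (hc' hs a) (hc' ht a)).trans ?_
        refine (Finset.sum_le_card_nsmul _ _ (dist s t) fun i _ => ?_).trans (by simp)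
        have h1 : |s i - t i| ≤ dist s t := by
          rw [dist_eq_norm]
          simpa using PiLp.norm_apply_le (s - t) i
        split_ifs
        · exact h1
        · rw [abs_sub_comm] at h1
          simpa using h1
      by_cases hv : c a = v
      · simpa [hv] using hd
      · simpa [Finsupp.single_apply, hv] using by positivity
    refine (Finset.abs_sum_le_sum_abs _ _).trans
      ((Finset.sum_le_card_nsmul _ _ _ fun a _ => hterm a).trans ?_)
    simp only [Finset.card_univ, Fintype.card_pi, Fintype.card_bool, Finset.prod_const,
      Fintype.card_fin, nsmul_eq_mul, Nat.cast_pow, Nat.cast_ofNat, ← mul_assoc]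
    gcongr
    norm_num
  have hpath : ∀ {x y : CubeComplex G} {r : ℝ}, PathOfLength G x y r →
      ∀ v, |x.1 v - y.1 v| ≤ 2 ^ N * N * r := by
    intro x y r h v
    induction h with
    | refl => simp
    | snoc _ h ih =>
      rw [mul_add]
      exact (abs_sub_le _ _ _).trans (add_le_add ih (hstep h v))
  refine Subtype.ext (Finsupp.ext fun v => ?_)
  by_contra hne
  have hpos : 0 < |x.1 v - y.1 v| := abs_pos.mpr (sub_ne_zero.mpr hne)
  have hK : (0 : ℝ) < 2 ^ N * N + 1 := by positivity
  obtain ⟨l, hl, hl'⟩ := exists_lt_of_csInf_lt (exists_path IsMedianGraph.connected x y)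
    (show pathDist G x y < |x.1 v - y.1 v| / (2 ^ N * N + 1) from h.trans_lt (div_pos hpos hK))
  rw [lt_div_iff₀ hK] at hl'
  have := hpath hl v
  have := PathOfLength.nonneg hl
  linarith

end CubeComplex

/-- `f` is a quasiisometry: a quasiisometric embedding with coarsely dense image. -/
def IsQuasiIsometry {X Y : Type*} [PseudoMetricSpace X] [PseudoMetricSpace Y] (f : X → Y) : Prop :=
  ∃ q : ℝ, 1 ≤ q ∧
    (∀ x x' : X, q⁻¹ * dist x x' - q ≤ dist (f x) (f x') ∧ dist (f x) (f x') ≤ q * dist x x' + q) ∧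
    ∀ y : Y, ∃ x : X, dist (f x) y ≤ q

/-- `X` and `Y` are quasiisometric. (This relation is symmetric.) -/
def QuasiIsometric (X Y : Type*) [PseudoMetricSpace X] [PseudoMetricSpace Y] : Prop :=
  ∃ f : X → Y, IsQuasiIsometry f

/-! The nonpositive curvature of $d_2$ is never used; the argument finds a proper part of $X$ and
takes a limit of almost geodesics there. Let `f` be a quasiisometry from $S=\mathbb R$ or
$S=[0,\infty)$ to $X$, and pick vertices $p(t)$ near $f(t)$. Going to the two ends of $S$ (for the
ray, one end and the origin) gives ultrafilters $\mathcal A,\mathcal B$ on the vertices. Send a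
vertex $x$ to the median $\varphi(x)$ of $x$, $\mathcal A$ and $\mathcal B$: it lies in exactly
those halfspaces that contain at least two of the three (`IsEndMedian`). It exists because medians
of $a,x,b$ stay at bounded distance from $x$ as $a,b$ go to the ends (`exists_med_bound`: a path
along a quasiline cannot avoid its middle, `exists_chain_dist_le`), and because in finite dimension
a bounded ultrafilter has a limit vertex (`exists_limit`). The majority rule makes $\varphi$
idempotent, betweenness preserving and nonstretching on edges, with convex fixed set. That set is
locally finite: each edge from a vertex to a fixed neighbour points towards $\mathcal A$ or
$\mathcal B$, and edges at one vertex with a common target span a cube (`exists_cube_of_adj`). So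
$\varphi$ extends to a 1-Lipschitz $\Phi:X\to X$ whose image has relatively compact bounded parts
and which has fixed points uniformly close to $f(S)$ (`exists_retraction`). Almost shortest paths
between fixed points far out in the two directions remain almost shortest under $\Phi$, and they
pass through a bounded region. Their pointwise limit along an ultrafilter is the required isometric
embedding (`exists_isometric_of_almost_geodesics`). -/

namespace IsMedianGraph

/-! ### Betweenness, medians and halfspaces in a median graph. -/

variable {V : Type*} {G : SimpleGraph V}

/-- `y` lies on a geodesic of `G` from `x` to `z`. -/
def Btw (G : SimpleGraph V) (x y z : V) : Prop :=
  G.dist x z = G.dist x y + G.dist y z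

theorem Btw.symm {x y z : V} (h : Btw G x y z) : Btw G z y x := by
  unfold Btw at *
  rw [G.dist_comm (u := z), G.dist_comm (u := z) (v := y), G.dist_comm (u := y) (v := x)]
  omega

/-- The vertices closer to `a` than to `b`. -/
def halfspace (G : SimpleGraph V) (a b : V) : Set V := {x | G.dist x a < G.dist x b}

/-- The halfspaces of `G` are the sides of its edges. -/
def IsHalfspace (G : SimpleGraph V) (W : Set V) : Prop :=
  ∃ a b, G.Adj a b ∧ W = halfspace G a b

theorem mem_halfspace_left {a b : V} (h : G.Adj a b) : a ∈ halfspace G a b := by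
  simp [halfspace, SimpleGraph.dist_eq_one_iff_adj.mpr h]

theorem notMem_halfspace_right {a b : V} : b ∉ halfspace G a b := by
  simp [halfspace]

theorem isHalfspace_halfspace {a b : V} (h : G.Adj a b) : IsHalfspace G (halfspace G a b) :=
  ⟨a, b, h, rfl⟩

variable [IsMedianGraph G]

theorem dist_triangle (G : SimpleGraph V) [IsMedianGraph G] (x y z : V) :
    G.dist x z ≤ G.dist x y + G.dist y z :=
  (connected (G := G)).dist_triangle

theorem eq_of_dist_eq_zero {x y : V} (h : G.dist x y = 0) : x = y :=
  (connected (G := G)).dist_eq_zero_iff.mp h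

theorem eq_of_btw_btw {x y z : V} (h : Btw G x y z) (h' : Btw G x z y) : y = z := by
  refine eq_of_dist_eq_zero (G := G) ?_
  unfold Btw at *
  rw [G.dist_comm (u := z)] at h'
  omega

theorem btw_comp {x y z w : V} (h : Btw G x y w) (h' : Btw G y z w) :
    Btw G x z w ∧ Btw G x y z := by
  have := dist_triangle G x y z
  have := dist_triangle G x z w
  unfold Btw at *
  omega

/-- The median of three vertices. -/
noncomputable def med (G : SimpleGraph V) [IsMedianGraph G] (u v w : V) : V :=
  (existsUnique_median (G := G) u v w).choose

theorem btw_med_left (u v w : V) : Btw G u (med G u v w) v :=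
  (existsUnique_median (G := G) u v w).choose_spec.1.1

theorem btw_med_right (u v w : V) : Btw G v (med G u v w) w :=
  (existsUnique_median (G := G) u v w).choose_spec.1.2.1

theorem btw_med_outer (u v w : V) : Btw G u (med G u v w) w :=
  (existsUnique_median (G := G) u v w).choose_spec.1.2.2

theorem median_unique {u v w m m' : V} (h₁ : Btw G u m v) (h₂ : Btw G v m w) (h₃ : Btw G u m w)
    (h₁' : Btw G u m' v) (h₂' : Btw G v m' w) (h₃' : Btw G u m' w) : m = m' :=
  (existsUnique_median (G := G) u v w).unique ⟨h₁, h₂, h₃⟩ ⟨h₁', h₂', h₃'⟩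

/-- The median of `a`, `b`, `x` lies on the edge, so it is `a` or `b`: median graphs are bipartite.
-/
theorem dist_adj {a b : V} (h : G.Adj a b) (x : V) :
    G.dist x b = G.dist x a + 1 ∨ G.dist x a = G.dist x b + 1 := by
  have h1 : G.dist a b = 1 := SimpleGraph.dist_eq_one_iff_adj.mpr h
  have e1 := btw_med_left (G := G) a b x
  have e2 := btw_med_right (G := G) a b x
  have e3 := btw_med_outer (G := G) a b x
  generalize med G a b x = m at *
  unfold Btw at *
  rw [G.dist_comm (u := x) (v := a), G.dist_comm (u := x) (v := b)]
  rw [G.dist_comm (u := b) (v := m)] at e2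
  omega

theorem mem_halfspace_iff {a b : V} (h : G.Adj a b) {x : V} :
    x ∈ halfspace G a b ↔ G.dist x b = G.dist x a + 1 := by
  have := dist_adj h x
  simp only [halfspace, Set.mem_ofPred_eq]
  omega

theorem compl_halfspace {a b : V} (h : G.Adj a b) : (halfspace G a b)ᶜ = halfspace G b a := by
  ext x
  have := dist_adj h x
  simp only [halfspace, Set.mem_ofPred_eq, Set.mem_compl_iff]
  omega

theorem IsHalfspace.compl {W : Set V} (h : IsHalfspace G W) : IsHalfspace G Wᶜ := by
  obtain ⟨a, b, hab, rfl⟩ := h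
  exact ⟨b, a, hab.symm, compl_halfspace hab⟩

theorem mem_halfspace_of_btw {a b x p : V} (h : G.Adj a b) (hx : x ∈ halfspace G a b)
    (hp : Btw G x p a) : p ∈ halfspace G a b := by
  have := dist_triangle G x p b
  have := (mem_halfspace_iff h).mp hx
  have := dist_adj h p
  rw [mem_halfspace_iff h]
  unfold Btw at *
  omega

theorem btw_of_mem_halfspace {a b x p : V} (h : G.Adj a b) (hx : x ∈ halfspace G a b)
    (hp : Btw G x p a) : Btw G x p b := by
  have h1 := (mem_halfspace_iff h).mp hx
  have h2 := (mem_halfspace_iff h).mp (mem_halfspace_of_btw h hx hp)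
  unfold Btw at *
  omega

/-- If `z` is on the `b`-side of the edge `ab` and `x` is on a geodesic from `z` to `a` but on
the `a`-side, then the median of `z`, `x`, `b` is adjacent to `x`. -/
theorem dist_med_of_cross {a b x z : V} (h : G.Adj a b) (hx : x ∈ halfspace G a b)
    (hz : z ∈ halfspace G b a) (hb : Btw G z x a) :
    G.dist z x = G.dist z (med G z x b) + 1 ∧ G.dist (med G z x b) x = 1 ∧
      med G z x b ∈ halfspace G b a ∧ G.dist (med G z x b) b = G.dist x a := by
  have h1 := (mem_halfspace_iff h).mp hx
  have h2 := (mem_halfspace_iff h.symm).mp hz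
  have e1 := btw_med_left (G := G) z x b
  have e2 := btw_med_right (G := G) z x b
  have e3 := btw_med_outer (G := G) z x b
  have h4 := mem_halfspace_of_btw h.symm hz e3
  generalize med G z x b = m at *
  unfold Btw at *
  rw [G.dist_comm (u := x) (v := m)] at e2
  refine ⟨?_, ?_, h4, ?_⟩ <;> omega

/-- A geodesic that leaves the `a`-side and returns would give `x`, `y`, `b` two medians, one on
each side of the edge. -/
theorem halfspace_convex {a b x y z : V} (h : G.Adj a b) (hx : x ∈ halfspace G a b)
    (hy : y ∈ halfspace G a b) (hz : Btw G x z y) : z ∈ halfspace G a b := by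
  by_contra hza
  have hzb : z ∈ halfspace G b a := by rw [← compl_halfspace h]; exact hza
  -- we may assume that `x` and `y` lie on geodesics from `z` to `a`
  obtain ⟨x, y, hx, hy, hz, hxa, hya⟩ : ∃ x y, x ∈ halfspace G a b ∧ y ∈ halfspace G a b ∧
      Btw G x z y ∧ Btw G z x a ∧ Btw G z y a := by
    refine ⟨med G x z a, med G y z a,
      mem_halfspace_of_btw h hx (btw_med_outer x z a), mem_halfspace_of_btw h hy
      (btw_med_outer y z a), ?_, btw_med_right x z a, btw_med_right y z a⟩
    have e1 := btw_med_left (G := G) x z a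
    have e2 := (btw_med_left (G := G) y z a).symm
    generalize med G x z a = p at *
    generalize med G y z a = q at *
    have := dist_triangle G p z q
    have := dist_triangle G x p q
    have := dist_triangle G x q y
    unfold Btw at *
    omega
  obtain ⟨s1, s2, s3, s4⟩ := dist_med_of_cross h hx hzb hxa
  obtain ⟨t1, t2, t3, t4⟩ := dist_med_of_cross h hy hzb hya
  have m1 := btw_med_left (G := G) x y a
  have m2 := btw_med_right (G := G) x y a
  have m3 := btw_med_outer (G := G) x y a
  have hm := mem_halfspace_of_btw h hx m3
  have m2' := btw_of_mem_halfspace h hy m2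
  have m3' := btw_of_mem_halfspace h hx m3
  have hm' := (mem_halfspace_iff h).mp hm
  generalize med G z x b = s at *
  generalize med G z y b = t at *
  have n1 := btw_med_left (G := G) s t b
  have n2 := btw_med_right (G := G) s t b
  have n3 := btw_med_outer (G := G) s t b
  have hn := mem_halfspace_of_btw h.symm s3 n3
  generalize med G x y a = m at *
  generalize med G s t b = n at *
  have q1 := (mem_halfspace_iff h).mp hx
  have q2 := (mem_halfspace_iff h).mp hy
  -- Here `s`, `t` are neighbours of `x`, `y` across the edge, on geodesics to `z` and to `b`. Hence
  -- the median `n` of `s`, `t`, `b` is also one of `x`, `y`, `b`, and so is `m`.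
  have : m = n := by
    have c1 := G.dist_comm (u := x) (v := s)
    have c2 := G.dist_comm (u := x) (v := z)
    have c3 := G.dist_comm (u := z) (v := s)
    have c4 := G.dist_comm (u := m) (v := y)
    have c5 := G.dist_comm (u := n) (v := t)
    have c6 := G.dist_comm (u := y) (v := n)
    have T1 := dist_triangle G x s n
    have T2 := dist_triangle G n t y
    have T3 := dist_triangle G x n y
    have T4 := dist_triangle G s z t
    have T5 := dist_triangle G x s t
    have T6 := dist_triangle G x t y
    have T7 := dist_triangle G x n b
    have T8 := dist_triangle G y n b
    refine median_unique m1 m2' m3' ?_ ?_ ?_ <;> unfold Btw at * <;> omega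
  subst this
  rw [← compl_halfspace h] at hn
  exact hn hm

theorem IsHalfspace.convex {W : Set V} (hW : IsHalfspace G W) {x y z : V} (hx : x ∈ W)
    (hy : y ∈ W) (hz : Btw G x z y) : z ∈ W := by
  obtain ⟨a, b, h, rfl⟩ := hW
  exact halfspace_convex h hx hy hz

/-- Majority rule, from convexity of both `W` and its complement. It reduces statements about
medians to propositional logic. -/
theorem IsHalfspace.med_mem_iff {W : Set V} (hW : IsHalfspace G W) {x y z : V} :
    med G x y z ∈ W ↔ (x ∈ W ∧ y ∈ W) ∨ (y ∈ W ∧ z ∈ W) ∨ (x ∈ W ∧ z ∈ W) := by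
  have key : ∀ {W : Set V}, IsHalfspace G W →
      (x ∈ W ∧ y ∈ W) ∨ (y ∈ W ∧ z ∈ W) ∨ (x ∈ W ∧ z ∈ W) → med G x y z ∈ W := by
    rintro W hW (h | h | h)
    · exact hW.convex h.1 h.2 (btw_med_left x y z)
    · exact hW.convex h.1 h.2 (btw_med_right x y z)
    · exact hW.convex h.1 h.2 (btw_med_outer x y z)
  refine ⟨fun h => ?_, key hW⟩
  by_contra hc
  refine key hW.compl ?_ h
  simp only [Set.mem_compl_iff]
  tauto

theorem exists_adj_btw {x y : V} (h : x ≠ y) : ∃ x', G.Adj x x' ∧ Btw G x x' y := by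
  obtain ⟨p, hp⟩ := (connected (G := G)).exists_walk_length_eq_dist x y
  cases p with
  | nil => exact absurd rfl h
  | @cons _ x' _ hadj q =>
    refine ⟨x', hadj, ?_⟩
    have h1 : G.dist x x' = 1 := SimpleGraph.dist_eq_one_iff_adj.mpr hadj
    have h2 := SimpleGraph.dist_le q
    have h3 := dist_triangle G x x' y
    simp only [SimpleGraph.Walk.length_cons] at hp
    unfold Btw
    omega

theorem mem_halfspace_of_adj_btw {x x' y : V} (h : G.Adj x x') (hb : Btw G x x' y) :
    y ∈ halfspace G x' x := by
  have h1 : G.dist x x' = 1 := SimpleGraph.dist_eq_one_iff_adj.mpr h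
  rw [mem_halfspace_iff h.symm, G.dist_comm, G.dist_comm (u := y) (v := x')]
  unfold Btw at hb
  omega

theorem btw_of_mem_halfspace_adj {x x' y : V} (h : G.Adj x x') (hy : y ∈ halfspace G x' x) :
    Btw G x x' y := by
  have h1 : G.dist x x' = 1 := SimpleGraph.dist_eq_one_iff_adj.mpr h
  rw [mem_halfspace_iff h.symm, G.dist_comm, G.dist_comm (u := y) (v := x')] at hy
  unfold Btw
  omega

/-- Betweenness is detected by halfspaces. -/
theorem btw_of_forall_halfspace {x y z : V}
    (h : ∀ W, IsHalfspace G W → x ∈ W → z ∈ W → y ∈ W) : Btw G x y z := by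
  by_contra hn
  have hne : y ≠ med G x y z := fun he => hn (by rw [he]; exact btw_med_outer x y z)
  obtain ⟨y', hadj, hb⟩ := exists_adj_btw (G := G) hne
  refine notMem_halfspace_right (h _ (isHalfspace_halfspace hadj.symm) ?_ ?_)
  · exact mem_halfspace_of_adj_btw hadj (btw_comp (btw_med_left x y z) hb.symm).1.symm
  · exact mem_halfspace_of_adj_btw hadj (btw_comp (btw_med_right x y z).symm hb.symm).1.symm

theorem exists_halfspace_of_ne {x y : V} (h : x ≠ y) :
    ∃ W, IsHalfspace G W ∧ x ∈ W ∧ y ∉ W := by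
  obtain ⟨x', hadj, hb⟩ := exists_adj_btw (G := G) h
  refine ⟨_, isHalfspace_halfspace hadj, mem_halfspace_left hadj, ?_⟩
  rw [← Set.mem_compl_iff, compl_halfspace hadj]
  exact mem_halfspace_of_adj_btw hadj hb

/-- A point of `W` nearer to `x'` would put `x'` on a geodesic between two points of the convex set
`W`; symmetrically for the complement. -/
theorem halfspace_eq_of_separates {x x' : V} (h : G.Adj x x') {W : Set V} (hW : IsHalfspace G W)
    (hx : x ∈ W) (hx' : x' ∉ W) : W = halfspace G x x' := by
  apply Set.Subset.antisymm
  · intro z hz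
    by_contra hz'
    rw [← Set.mem_compl_iff, compl_halfspace h] at hz'
    exact hx' (hW.convex hx hz (btw_of_mem_halfspace_adj h hz'))
  · intro z hz
    by_contra hz'
    exact hW.compl.convex (x := x') hx' hz' (btw_of_mem_halfspace_adj h.symm hz) hx

/-- Vertices separated by at most one halfspace are at distance at most one. -/
theorem dist_le_one_of_subsingleton {x y : V}
    (h : ∀ W W', IsHalfspace G W → IsHalfspace G W' → x ∈ W → y ∉ W → x ∈ W' → y ∉ W' → W = W') :
    G.dist x y ≤ 1 := by
  by_contra hlt
  have hne : x ≠ y := fun he => hlt (by simp [he])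
  obtain ⟨x', hadj, hb⟩ := exists_adj_btw (G := G) hne
  have h1 : G.dist x x' = 1 := SimpleGraph.dist_eq_one_iff_adj.mpr hadj
  have hne' : x' ≠ y := fun he => hlt (by rw [← he, h1])
  obtain ⟨W, hW, hx'W, hyW⟩ := exists_halfspace_of_ne (G := G) hne'
  have hxW : x ∈ W := by
    by_contra hxW
    exact hW.compl.convex hxW hyW hb hx'W
  have hy : y ∉ halfspace G x x' := by
    rw [← Set.mem_compl_iff, compl_halfspace hadj]
    exact mem_halfspace_of_adj_btw hadj hb
  have := h W _ hW (isHalfspace_halfspace hadj) hxW hyW (mem_halfspace_left hadj) hy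
  exact notMem_halfspace_right (this ▸ hx'W)

end IsMedianGraph

/-! ### Recognising cubes in a median graph. -/

namespace IsMedianGraph

variable {V : Type*} {G : SimpleGraph V}

/-- A map from the vertices of a cube to a graph that preserves betweenness. -/
def PreservesBtw (G : SimpleGraph V) {n : ℕ} (g : (Fin n → Bool) → V) : Prop :=
  ∀ a b c, (∀ i, b i = a i ∨ b i = c i) → Btw G (g a) (g b) (g c)

theorem hammingDist_eq_sum {n : ℕ} (a b : Fin n → Bool) :
    hammingDist a b = ∑ i, if a i ≠ b i then 1 else 0 := by
  rw [hammingDist, Finset.card_filter]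

theorem preservesBtw_of_isGraphCube {n : ℕ} {c : (Fin n → Bool) → V} (hc : IsGraphCube G c) :
    PreservesBtw G c := by
  intro x y z h
  unfold Btw
  rw [hc, hc, hc, hammingDist_eq_sum, hammingDist_eq_sum, hammingDist_eq_sum,
    ← Finset.sum_add_distrib]
  refine Finset.sum_congr rfl fun i _ => ?_
  rcases h i with h | h <;> simp [h]

/-- The image length of the edges in direction `i`. -/
noncomputable def edgeLength (G : SimpleGraph V) {n : ℕ} (g : (Fin n → Bool) → V) (i : Fin n) : ℕ :=
  G.dist (g fun _ => false) (g (Function.update (fun _ => false) i true))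

variable {n : ℕ} {g : (Fin n → Bool) → V}

/-- Opposite sides of a quadrilateral are equal if each vertex lies between its two neighbours;
summing the four relations shows this. -/
theorem PreservesBtw.dist_update_true (hg : PreservesBtw G g) {a : Fin n → Bool} {i : Fin n}
    (ha : a i = false) : G.dist (g a) (g (Function.update a i true)) = edgeLength G g i := by
  have h1 := hg (fun _ => false) (Function.update (fun _ => false) i true)
    (Function.update a i true) (fun j => by by_cases h : j = i <;> simp [h])
  have h2 := hg (Function.update (fun _ => false) i true) (Function.update a i true) a
    (fun j => by by_cases h : j = i <;> simp [h])
  have h3 := hg (Function.update a i true) a (fun _ => false)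
    (fun j => by by_cases h : j = i <;> simp [h, ha])
  have h4 := hg a (fun _ => false) (Function.update (fun _ => false) i true)
    (fun j => by by_cases h : j = i <;> simp [h, ha])
  unfold edgeLength
  generalize g (Function.update a i true) = z at *
  generalize g (Function.update (fun _ => false) i true) = y at *
  generalize g a = w at *
  generalize (g fun _ => false) = x at *
  have c1 := G.dist_comm (u := x) (v := z)
  have c2 := G.dist_comm (u := y) (v := w)
  have c3 := G.dist_comm (u := x) (v := w)
  have c4 := G.dist_comm (u := z) (v := w)
  unfold Btw at *
  omega

theorem PreservesBtw.dist_update (hg : PreservesBtw G g) (b : Fin n → Bool) (i : Fin n)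
    (β : Bool) : G.dist (g (Function.update b i β)) (g b) =
      if β ≠ b i then edgeLength G g i else 0 := by
  by_cases h : β = b i
  · subst h; simp
  · rw [if_pos h]
    cases hb : b i
    · have : β = true := by rw [hb] at h; simpa using h
      rw [this, G.dist_comm, hg.dist_update_true hb]
    · have : β = false := by rw [hb] at h; simpa using h
      subst this
      rw [← hg.dist_update_true (a := Function.update b i false) (i := i) (by simp)]
      simp only [Function.update_idem]
      rw [← hb, Function.update_eq_self]

theorem PreservesBtw.dist_eq_sum (hg : PreservesBtw G g) (a b : Fin n → Bool) :
    G.dist (g a) (g b) = ∑ i, if a i ≠ b i then edgeLength G g i else 0 := by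
  suffices H : ∀ (D : Finset (Fin n)) (b : Fin n → Bool), (∀ i ∉ D, a i = b i) →
      G.dist (g a) (g b) = ∑ i ∈ D, if a i ≠ b i then edgeLength G g i else 0 from
    H Finset.univ b (by simp)
  intro D
  induction D using Finset.induction_on with
  | empty =>
    intro b hb
    have : a = b := funext fun i => hb i (by simp)
    simp [this]
  | insert i D hi ih =>
    intro b hb
    have hbtw := hg a (Function.update b i (a i)) b
      (fun j => by by_cases h : j = i <;> [left; right] <;> simp [h])
    have h1 := ih (Function.update b i (a i)) (fun j hj => by
      by_cases h : j = i
      · simp [h]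
      · simpa [h] using hb j (by simp [h, hj]))
    unfold Btw at hbtw
    rw [Finset.sum_insert hi, hbtw, h1, hg.dist_update, add_comm]
    congr 1
    refine Finset.sum_congr rfl fun j hj => ?_
    have : j ≠ i := fun h => hi (h ▸ hj)
    simp [this]

variable [IsMedianGraph G]

/-- A betweenness preserving map that does not stretch edges factors through a coordinate
projection onto a cube of `G`. -/
theorem PreservesBtw.exists_factor (hg : PreservesBtw G g) (h1 : ∀ i, edgeLength G g i ≤ 1) :
    ∃ (m : ℕ) (ι : Fin m → Fin n) (c : (Fin m → Bool) → V), Function.Injective ι ∧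
      IsGraphCube G c ∧ (∀ a, g a = c (a ∘ ι)) ∧ ∀ b, ∃ a, c b = g a := by
  classical
  -- Directions outside `J` are collapsed by `g`, so their coordinates may be filled in with
  -- `false`.
  let J : Finset (Fin n) := Finset.univ.filter fun i => edgeLength G g i = 1
  let ι : Fin J.card → Fin n := J.orderEmbOfFin rfl
  have hι : Function.Injective ι := (J.orderEmbOfFin rfl).injective
  have hιJ : Set.range ι = J := Finset.range_orderEmbOfFin J rfl
  have hJ : ∀ i ∉ Set.range ι, edgeLength G g i = 0 := by
    intro i hi
    have := h1 i
    have : edgeLength G g i ≠ 1 := fun h => hi (by rw [hιJ]; simp [J, h])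
    omega
  have hJ' : ∀ k, edgeLength G g (ι k) = 1 := by
    intro k
    have : ι k ∈ (J : Set (Fin n)) := hιJ ▸ Set.mem_range_self k
    simpa [J] using this
  refine ⟨J.card, ι, fun b => g (Function.extend ι b fun _ => false), hι, ?_, ?_,
    fun b => ⟨_, rfl⟩⟩
  · intro b b'
    rw [hg.dist_eq_sum, hammingDist_eq_sum]
    refine (Fintype.sum_of_injective ι hι _ _ ?_ ?_).symm
    · intro i hi
      simp [hJ i hi]
    · intro k
      simp [hι.extend_apply, hJ']
  · intro a
    refine eq_of_dist_eq_zero (G := G) ?_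
    rw [hg.dist_eq_sum]
    refine Finset.sum_eq_zero fun i _ => ?_
    by_cases hi : i ∈ Set.range ι
    · obtain ⟨k, rfl⟩ := hi
      simp [hι.extend_apply]
    · simp [hJ i hi]

theorem adj_eq_of_halfspace_eq {y u v : V} (hu : G.Adj y u) (hv : G.Adj y v)
    (h : halfspace G u y = halfspace G v y) : u = v := by
  have h1 : Btw G y u v := btw_of_mem_halfspace_adj hu (h ▸ mem_halfspace_left hv.symm)
  have h2 : Btw G y v u := btw_of_mem_halfspace_adj hv (h ▸ mem_halfspace_left hu.symm)
  exact eq_of_btw_btw h1 h2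

/-- Neighbours of a vertex `y` that all lie on geodesics to a vertex `w` span a cube. -/
theorem exists_cube_of_adj {k : ℕ} {y w : V} {u : Fin k → V} (hu : ∀ i, G.Adj y (u i))
    (hinj : Function.Injective u) (hw : ∀ i, w ∈ halfspace G (u i) y) :
    ∃ c : (Fin k → Bool) → V, IsGraphCube G c := by
  classical
  -- The corner for `S` is separated from `y` by exactly the hyperplanes of the edges to `u j`, `j ∈
  -- S`. To add `i`, take the median with `u i` and `w`: as `w` is across all these hyperplanes, the
  -- majority rule becomes a union.
  have key : ∀ S : Finset (Fin k), ∃ c : V, ∀ W, IsHalfspace G W → y ∉ W →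
      (c ∈ W ↔ ∃ j ∈ S, W = halfspace G (u j) y) := by
    intro S
    induction S using Finset.induction_on with
    | empty => exact ⟨y, fun W _ hy => by simpa using hy⟩
    | insert i S _ ih =>
      obtain ⟨c, hc⟩ := ih
      refine ⟨med G c (u i) w, fun W hW hy => ?_⟩
      have hui : u i ∈ W ↔ W = halfspace G (u i) y := by
        refine ⟨fun h => halfspace_eq_of_separates (hu i).symm hW h hy, ?_⟩
        rintro rfl
        exact mem_halfspace_left (hu i).symm
      have hwW : ∀ j, W = halfspace G (u j) y → w ∈ W := fun j h => h ▸ hw j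
      rw [hW.med_mem_iff, hc W hW hy, hui]
      simp only [Finset.mem_insert, exists_eq_or_imp]
      constructor
      · rintro (h | h | h)
        · exact Or.inl h.2
        · exact Or.inl h.1
        · exact Or.inr h.1
      · rintro (h | h)
        · exact Or.inr (Or.inl ⟨h, hwW _ h⟩)
        · obtain ⟨j, hj, hjW⟩ := h
          exact Or.inr (Or.inr ⟨⟨j, hj, hjW⟩, hwW _ hjW⟩)
  choose c hc using key
  let g : (Fin k → Bool) → V := fun a => c (Finset.univ.filter fun i => a i = true)
  have hgW : ∀ a W, IsHalfspace G W → y ∉ W →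
      (g a ∈ W ↔ ∃ j, a j = true ∧ W = halfspace G (u j) y) := by
    intro a W hW hy
    simpa using hc (Finset.univ.filter fun i => a i = true) W hW hy
  have hg : PreservesBtw G g := by
    intro a b d hb
    refine btw_of_forall_halfspace fun W hW ha hd => ?_
    by_cases hy : y ∈ W
    · by_contra hbW
      have hy' : y ∉ Wᶜ := fun h => h hy
      obtain ⟨j, hj, hjW⟩ := (hgW b Wᶜ hW.compl hy').mp hbW
      rcases hb j with h | h
      · exact (hgW a Wᶜ hW.compl hy').mpr ⟨j, h ▸ hj, hjW⟩ ha
      · exact (hgW d Wᶜ hW.compl hy').mpr ⟨j, h ▸ hj, hjW⟩ hd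
    · obtain ⟨j, hj, hjW⟩ := (hgW a W hW hy).mp ha
      obtain ⟨l, hl, hlW⟩ := (hgW d W hW hy).mp hd
      have : j = l := hinj (adj_eq_of_halfspace_eq (hu j) (hu l) (hjW.symm.trans hlW))
      subst this
      refine (hgW b W hW hy).mpr ⟨j, ?_, hjW⟩
      rcases hb j with h | h
      · rw [h, hj]
      · rw [h, hl]
  have hlen : ∀ i, edgeLength G g i = 1 := by
    intro i
    refine le_antisymm ?_ (Nat.one_le_iff_ne_zero.mpr fun h0 => ?_)
    · have aux : ∀ W, IsHalfspace G W → (g fun _ => false) ∈ W →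
          g (Function.update (fun _ => false) i true) ∉ W → Wᶜ = halfspace G (u i) y := by
        intro W hW h0 h1
        by_cases hy : y ∈ W
        · have hy' : y ∉ Wᶜ := fun h => h hy
          obtain ⟨j, hj, hjW⟩ := (hgW _ Wᶜ hW.compl hy').mp h1
          have : j = i := by
            by_contra hne
            simp [hne] at hj
          exact this ▸ hjW
        · obtain ⟨j, hj, -⟩ := (hgW _ W hW hy).mp h0
          simp at hj
      refine dist_le_one_of_subsingleton fun W W' hW hW' h1 h2 h3 h4 => ?_
      exact compl_injective ((aux W hW h1 h2).trans (aux W' hW' h3 h4).symm)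
    · have he := eq_of_dist_eq_zero (G := G) h0
      have hH := isHalfspace_halfspace (hu i).symm
      have h1 := (hgW (Function.update (fun _ => false) i true) _ hH notMem_halfspace_right).mpr
        ⟨i, by simp, rfl⟩
      rw [← he] at h1
      obtain ⟨j, hj, -⟩ := (hgW _ _ hH notMem_halfspace_right).mp h1
      simp at hj
  refine ⟨g, fun a b => ?_⟩
  rw [hg.dist_eq_sum, hammingDist_eq_sum]
  simp [hlen]

theorem card_adj_le {N : ℕ}
    (hN : ∀ (n : ℕ) (c : (Fin n → Bool) → V), IsGraphCube G c → n ≤ N) {y w : V} {T : Finset V}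
    (hT : ∀ u ∈ T, G.Adj y u ∧ w ∈ halfspace G u y) : T.card ≤ N := by
  obtain ⟨c, hc⟩ := exists_cube_of_adj (G := G) (y := y) (w := w)
    (u := fun i => (T.equivFin.symm i : V)) (fun i => (hT _ (T.equivFin.symm i).2).1)
    (Subtype.val_injective.comp T.equivFin.symm.injective)
    (fun i => (hT _ (T.equivFin.symm i).2).2)
  exact hN _ c hc

end IsMedianGraph

/-! ### Limits of vertices along ultrafilters. -/

namespace IsMedianGraph

open Filter

variable {V : Type*} {G : SimpleGraph V} [IsMedianGraph G] {N : ℕ}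

/-- An ultrafilter on the vertices that contains a bounded set has a limit vertex. -/
theorem exists_limit (hN : ∀ (n : ℕ) (c : (Fin n → Bool) → V), IsGraphCube G c → n ≤ N)
    (𝒱 : Ultrafilter V) {o : V} {R : ℕ} (hR : ∀ᶠ v in 𝒱, G.dist o v ≤ R) :
    ∃ p, ∀ u, ∀ᶠ v in 𝒱, Btw G u p v := by
  classical
  -- The limit is a vertex `w` whose almost sure distance bound is minimal. If `w` fails for `u`,
  -- then almost every `v` has a neighbour of `w` nearer to both `u` and `v`; finitely many
  -- neighbours are nearer to `u`, so one serves almost all `v` and lowers the bound.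
  have hex : ∃ k, ∃ w, ∀ᶠ v in 𝒱, G.dist w v ≤ k := ⟨R, o, hR⟩
  obtain ⟨w, hw⟩ := Nat.find_spec hex
  refine ⟨w, fun u => ?_⟩
  by_contra hcon
  rw [← Ultrafilter.eventually_not] at hcon
  have hfin : {w' | G.Adj w w' ∧ u ∈ halfspace G w' w}.Finite := by
    by_contra hinf
    obtain ⟨T, hT, hTc⟩ := Set.Infinite.exists_subset_card_eq hinf (N + 1)
    have := card_adj_le hN (y := w) (w := u) (T := T) (fun x hx => hT hx)
    omega
  have hev : ∀ᶠ v in 𝒱, ∃ w' ∈ {w' | G.Adj w w' ∧ u ∈ halfspace G w' w},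
      G.Adj w w' ∧ Btw G w w' v := by
    filter_upwards [hcon] with v hv
    have hne : w ≠ med G u w v := fun he => hv (by rw [he]; exact btw_med_outer u w v)
    obtain ⟨w', hadj, hb⟩ := exists_adj_btw (G := G) hne
    exact ⟨w', ⟨hadj, mem_halfspace_of_adj_btw hadj
      (btw_comp (btw_med_left u w v) hb.symm).1.symm⟩, hadj,
      (btw_comp (btw_med_right u w v).symm hb.symm).1.symm⟩
  rw [Ultrafilter.eventually_exists_mem_iff hfin] at hev
  obtain ⟨w', -, hw'⟩ := hev
  have hlt : ∀ᶠ v in 𝒱, G.dist w' v ≤ Nat.find hex - 1 ∧ 1 ≤ Nat.find hex := by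
    filter_upwards [hw, hw'] with v h1 h2
    have h3 : G.dist w w' = 1 := SimpleGraph.dist_eq_one_iff_adj.mpr h2.1
    have h4 := h2.2
    unfold Btw at h4
    omega
  have h1 : 1 ≤ Nat.find hex := (hlt.exists).choose_spec.2
  exact Nat.find_min hex (m := Nat.find hex - 1) (by omega) ⟨w', hlt.mono fun v h => h.1⟩

theorem mem_iff_of_limit {𝒱 : Ultrafilter V} {p : V} (hp : ∀ u, ∀ᶠ v in 𝒱, Btw G u p v)
    {W : Set V} (hW : IsHalfspace G W) : p ∈ W ↔ W ∈ 𝒱 := by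
  have key : ∀ {W : Set V}, IsHalfspace G W → W ∈ 𝒱 → p ∈ W := by
    intro W hW hmem
    obtain ⟨a, b, hab, rfl⟩ := id hW
    obtain ⟨v, h1, h2⟩ := ((hp a).and hmem).exists
    exact hW.convex (mem_halfspace_left hab) h2 h1
  refine ⟨fun h => ?_, key hW⟩
  by_contra hn
  exact key hW.compl (Ultrafilter.compl_mem_iff_notMem.mpr hn) h

/-- `p` is the median of the vertex `x` and the two ends given by the ultrafilters `𝒜`, `ℬ`. -/
def IsEndMedian (G : SimpleGraph V) (𝒜 ℬ : Ultrafilter V) (x p : V) : Prop :=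
  ∀ W, IsHalfspace G W → (p ∈ W ↔ (W ∈ 𝒜 ∧ x ∈ W) ∨ (x ∈ W ∧ W ∈ ℬ) ∨ (W ∈ 𝒜 ∧ W ∈ ℬ))

/-- The limit of `med G a x b` along the iterated ultrafilter. Ultrafilters commute with "and" and
"or", so the majority rule survives. The second clause carries uniform distance bounds over to the
limit. -/
theorem exists_isEndMedian
    (hN : ∀ (n : ℕ) (c : (Fin n → Bool) → V), IsGraphCube G c → n ≤ N)
    (𝒜 ℬ : Ultrafilter V) {x : V} {R : ℕ}
    (hR : ∀ᶠ a in 𝒜, ∀ᶠ b in ℬ, G.dist x (med G a x b) ≤ R) :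
    ∃ p, IsEndMedian G 𝒜 ℬ x p ∧
      ∀ R : ℕ, (∀ᶠ a in 𝒜, ∀ᶠ b in ℬ, G.dist x (med G a x b) ≤ R) → G.dist x p ≤ R := by
  let 𝒱 : Ultrafilter V := 𝒜.bind fun a => ℬ.map fun b => med G a x b
  have hmem : ∀ {P : V → Prop}, (∀ᶠ v in 𝒱, P v) ↔ ∀ᶠ a in 𝒜, ∀ᶠ b in ℬ, P (med G a x b) :=
    Iff.rfl
  have hV : ∀ᶠ v in 𝒱, G.dist x v ≤ R := hmem.mpr hR
  obtain ⟨p, hp⟩ := exists_limit hN 𝒱 hV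
  refine ⟨p, fun W hW => ?_, fun R' hR' => ?_⟩
  · rw [mem_iff_of_limit hp hW]
    have h1 : W ∈ 𝒱 ↔ ∀ᶠ a in 𝒜, ∀ᶠ b in ℬ,
        (a ∈ W ∧ x ∈ W) ∨ (x ∈ W ∧ b ∈ W) ∨ (a ∈ W ∧ b ∈ W) := by
      have h2 : W ∈ 𝒱 ↔ ∀ᶠ a in 𝒜, ∀ᶠ b in ℬ, med G a x b ∈ W := Iff.rfl
      rw [h2]
      simp only [hW.med_mem_iff]
    have hA : W ∈ 𝒜 ↔ ∀ᶠ a in 𝒜, a ∈ W := Iff.rfl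
    have hB : W ∈ ℬ ↔ ∀ᶠ b in ℬ, b ∈ W := Iff.rfl
    simp only [h1, hA, hB, Ultrafilter.eventually_or, eventually_and, eventually_const]
  · obtain ⟨v, h1, h2⟩ := ((hp x).and (hmem (P := fun v => G.dist x v ≤ R').mpr hR')).exists
    unfold Btw at h1
    omega

/-! ### The retraction onto the span of two ends. -/

section Retraction

variable {𝒜 ℬ : Ultrafilter V} {φ : V → V} (hφ : ∀ x, IsEndMedian G 𝒜 ℬ x (φ x))

include hφ

/-- For fixed `W` the votes of `𝒜` and `ℬ` are constant, so `φ x ∈ W` depends monotonically on `x ∈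
W`. -/
theorem endMedian_btw {x y z : V} (h : Btw G x y z) : Btw G (φ x) (φ y) (φ z) := by
  refine btw_of_forall_halfspace fun W hW hx hz => ?_
  rw [hφ _ W hW] at hx hz ⊢
  have : x ∈ W → z ∈ W → y ∈ W := fun hx hz => hW.convex hx hz h
  tauto

theorem endMedian_dist_le_one {x y : V} (h : G.Adj x y) : G.dist (φ x) (φ y) ≤ 1 := by
  have aux : ∀ W, IsHalfspace G W → φ x ∈ W → φ y ∉ W → W = halfspace G x y := by
    intro W hW hx hy
    rw [hφ _ W hW] at hx hy
    exact halfspace_eq_of_separates h hW (by tauto) (by tauto)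
  exact dist_le_one_of_subsingleton fun W W' hW hW' h1 h2 h3 h4 =>
    (aux W hW h1 h2).trans (aux W' hW' h3 h4).symm

/-- The vote of `y` is overruled only when both ends are on the other side of a halfspace. -/
theorem endMedian_eq_self {y : V} (hy : ∀ W, IsHalfspace G W → y ∈ W → W ∈ 𝒜 ∨ W ∈ ℬ) :
    φ y = y := by
  by_contra hne
  obtain ⟨W, hW, h1, h2⟩ := exists_halfspace_of_ne (G := G) hne
  rw [hφ _ W hW] at h1
  rcases hy Wᶜ hW.compl h2 with h | h <;> rw [Ultrafilter.compl_mem_iff_notMem] at h <;> tauto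

omit [IsMedianGraph G] in
theorem mem_or_mem_of_endMedian_mem {x : V} {W : Set V} (hW : IsHalfspace G W) (h : φ x ∈ W) :
    W ∈ 𝒜 ∨ W ∈ ℬ := by
  rw [hφ _ W hW] at h
  tauto

theorem endMedian_idem (x : V) : φ (φ x) = φ x :=
  endMedian_eq_self hφ fun _ hW h => mem_or_mem_of_endMedian_mem hφ hW h

theorem endMedian_convex {x y z : V} (hx : φ x = x) (hz : φ z = z) (h : Btw G x y z) :
    φ y = y := by
  refine endMedian_eq_self hφ fun W hW hy => ?_
  by_contra hcon
  have hx' : x ∉ W := fun hxW => hcon (mem_or_mem_of_endMedian_mem hφ (x := x) hW (hx.symm ▸ hxW))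
  have hz' : z ∉ W := fun hzW => hcon (mem_or_mem_of_endMedian_mem hφ (x := z) hW (hz.symm ▸ hzW))
  exact hW.compl.convex hx' hz' h hy

/-- For a fixed neighbour `u`, its side of the edge belongs to `𝒜` or `ℬ`. Finitely many sets of one
ultrafilter share a vertex `w`, so by `card_adj_le` each end accounts for at most `N` neighbours. -/
theorem endMedian_finite_adj
    (hN : ∀ (n : ℕ) (c : (Fin n → Bool) → V), IsGraphCube G c → n ≤ N) (y : V) :
    {u | G.Adj y u ∧ φ u = u}.Finite := by
  have key : ∀ 𝒰 : Ultrafilter V, {u | G.Adj y u ∧ halfspace G u y ∈ 𝒰}.Finite := by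
    intro 𝒰
    by_contra hinf
    obtain ⟨T, hT, hTc⟩ := Set.Infinite.exists_subset_card_eq hinf (N + 1)
    have : ∀ᶠ w in 𝒰, ∀ u ∈ T, w ∈ halfspace G u y :=
      (eventually_all_finset T).mpr fun u hu => (hT hu).2
    obtain ⟨w, hw⟩ := this.exists
    have := card_adj_le hN (y := y) (w := w) (T := T) fun x hx => ⟨(hT hx).1, hw x hx⟩
    omega
  refine ((key 𝒜).union (key ℬ)).subset ?_
  rintro u ⟨hadj, hu⟩
  have := mem_or_mem_of_endMedian_mem hφ (x := u) (isHalfspace_halfspace hadj.symm)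
    (hu.symm ▸ mem_halfspace_left hadj.symm)
  exact this.imp (fun h => ⟨hadj, h⟩) (fun h => ⟨hadj, h⟩)

/-- Fixed vertices form a convex set, so each is reached from `o` through fixed vertices, with
finitely many choices per step. -/
theorem endMedian_finite_ball
    (hN : ∀ (n : ℕ) (c : (Fin n → Bool) → V), IsGraphCube G c → n ≤ N) {o : V} (ho : φ o = o)
    (R : ℕ) : {y | φ y = y ∧ G.dist o y ≤ R}.Finite := by
  induction R with
  | zero =>
    refine (Set.finite_singleton o).subset ?_
    rintro y ⟨-, hy⟩
    exact (eq_of_dist_eq_zero (G := G) (Nat.le_zero.mp hy)).symm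
  | succ R ih =>
    refine ((Set.finite_singleton o).union
      (ih.biUnion fun z _ => endMedian_finite_adj hφ hN z)).subset ?_
    rintro y ⟨hy, hd⟩
    by_cases hyo : y = o
    · exact Or.inl hyo
    · obtain ⟨z, hadj, hb⟩ := exists_adj_btw (G := G) hyo
      refine Or.inr (Set.mem_biUnion (x := z) ⟨endMedian_convex hφ hy ho hb, ?_⟩ ⟨hadj.symm, hy⟩)
      have h1 : G.dist y z = 1 := SimpleGraph.dist_eq_one_iff_adj.mpr hadj
      unfold Btw at hb
      rw [G.dist_comm, G.dist_comm (u := z)] at hb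
      omega

end Retraction

end IsMedianGraph

/-! ### Extending vertex maps to the cube complex, and compact subcomplexes. -/

namespace CubeComplex

open IsMedianGraph

variable {V : Type*} {G : SimpleGraph V}

/-- The weight of the corner `a` in the multilinear interpolation at `s`. -/
noncomputable def weight {n : ℕ} (s : EuclideanSpace ℝ (Fin n)) (a : Fin n → Bool) : ℝ :=
  ∏ i, if a i then s i else 1 - s i

theorem cubePoint_eq {n : ℕ} (c : (Fin n → Bool) → V) (s : EuclideanSpace ℝ (Fin n)) :
    cubePoint c s = ∑ a, Finsupp.single (c a) (weight s a) := rfl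

/-- The coordinates of `s` selected by `ι`. -/
noncomputable def reindex {m n : ℕ} (ι : Fin m → Fin n) (s : EuclideanSpace ℝ (Fin n)) :
    EuclideanSpace ℝ (Fin m) :=
  WithLp.toLp 2 fun k => s (ι k)

theorem reindex_mem {m n : ℕ} (ι : Fin m → Fin n) {s : EuclideanSpace ℝ (Fin n)}
    (hs : s ∈ unitCube n) : reindex ι s ∈ unitCube m :=
  fun k => hs (ι k)

theorem dist_reindex_le {m n : ℕ} {ι : Fin m → Fin n} (hι : Function.Injective ι)
    (s t : EuclideanSpace ℝ (Fin n)) : dist (reindex ι s) (reindex ι t) ≤ dist s t := by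
  rw [EuclideanSpace.dist_eq, EuclideanSpace.dist_eq]
  refine Real.sqrt_le_sqrt ?_
  calc ∑ k, dist (s (ι k)) (t (ι k)) ^ 2
      = ∑ i ∈ Finset.univ.map ⟨ι, hι⟩, dist (s i) (t i) ^ 2 := by simp
    _ ≤ ∑ i, dist (s i) (t i) ^ 2 :=
      Finset.sum_le_univ_sum_of_nonneg fun i => by positivity

/-- The weights form a product, and each forgotten coordinate contributes $s_i+(1-s_i)=1$: a
marginal of a product measure. -/
theorem sum_weight_fiber {m n : ℕ} {ι : Fin m → Fin n} (hι : Function.Injective ι)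
    (s : EuclideanSpace ℝ (Fin n)) (b : Fin m → Bool) :
    ∑ a with a ∘ ι = b, weight s a = weight (reindex ι s) b := by
  classical
  let t : Fin n → Finset Bool := fun i => Finset.univ.filter fun β => ∀ k, ι k = i → β = b k
  have hfib : (Finset.univ.filter fun a : Fin n → Bool => a ∘ ι = b) = Fintype.piFinset t := by
    ext a
    simp only [Finset.mem_filter, Finset.mem_univ, true_and, Fintype.mem_piFinset, t,
      funext_iff, Function.comp_apply]
    exact ⟨fun h i k hk => hk ▸ h k, fun h k => h _ k rfl⟩
  rw [hfib]
  unfold weight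
  rw [← Finset.prod_univ_sum t (fun i β => if β = true then s i else 1 - s i)]
  refine (Fintype.prod_of_injective ι hι _ _ ?_ ?_).symm
  · intro i hi
    have : t i = Finset.univ := by
      refine Finset.filter_true_of_mem fun β _ k hk => ?_
      exact absurd ⟨k, hk⟩ hi
    simp [this]
  · intro k
    have : t (ι k) = {b k} := by
      ext β
      simp only [t, Finset.mem_filter, Finset.mem_univ, true_and, Finset.mem_singleton]
      exact ⟨fun h => h k rfl, fun h l hl => by rw [h, hι hl]⟩
    simp [this, reindex]

theorem sum_weight {n : ℕ} (s : EuclideanSpace ℝ (Fin n)) : ∑ a, weight s a = 1 := by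
  have h := sum_weight_fiber (ι := (Fin.elim0 : Fin 0 → Fin n)) (fun i => i.elim0) s ![]
  rw [Finset.filter_true_of_mem fun a _ => Subsingleton.elim _ _] at h
  rw [h]
  simp [weight]

theorem mapDomain_cubePoint {m n : ℕ} {ι : Fin m → Fin n} (hι : Function.Injective ι)
    {φ : V → V} {c : (Fin n → Bool) → V} {c' : (Fin m → Bool) → V}
    (h : ∀ a, φ (c a) = c' (a ∘ ι)) (s : EuclideanSpace ℝ (Fin n)) :
    (cubePoint c s).mapDomain φ = cubePoint c' (reindex ι s) := by
  classical
  rw [cubePoint_eq, cubePoint_eq, Finsupp.mapDomain_finsetSum]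
  simp only [Finsupp.mapDomain_single, h]
  rw [← Finset.sum_fiberwise (s := Finset.univ) (g := fun a : Fin n → Bool => a ∘ ι)]
  refine Finset.sum_congr rfl fun b _ => ?_
  rw [← sum_weight_fiber hι, Finsupp.single_finsetSum]
  refine Finset.sum_congr rfl fun a ha => ?_
  rw [(Finset.mem_filter.mp ha).2]

/-- The point of the complex with coordinates `s` in the cube `c`. -/
noncomputable def mk {n : ℕ} {c : (Fin n → Bool) → V} (hc : IsGraphCube G c) (s : unitCube n) :
    CubeComplex G :=
  ⟨cubePoint c s, n, c, s, hc, s.2, rfl⟩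

theorem exists_mk_eq (x : CubeComplex G) :
    ∃ (n : ℕ) (c : (Fin n → Bool) → V) (hc : IsGraphCube G c) (s : unitCube n), x = mk hc s := by
  obtain ⟨x, n, c, s, hc, hs, rfl⟩ := x
  exact ⟨n, c, hc, ⟨s, hs⟩, rfl⟩

/-- A vertex map that preserves betweenness and does not stretch edges. -/
structure IsCubical (G : SimpleGraph V) (φ : V → V) : Prop where
  btw : ∀ {x y z}, Btw G x y z → Btw G (φ x) (φ y) (φ z)
  dist_le_one : ∀ {x y}, G.Adj x y → G.dist (φ x) (φ y) ≤ 1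

variable [IsMedianGraph G] {φ : V → V}

theorem IsCubical.exists_cube (hφ : IsCubical G φ) {n : ℕ} {c : (Fin n → Bool) → V}
    (hc : IsGraphCube G c) :
    ∃ (m : ℕ) (ι : Fin m → Fin n) (c' : (Fin m → Bool) → V), Function.Injective ι ∧
      IsGraphCube G c' ∧ (∀ a, φ (c a) = c' (a ∘ ι)) ∧ ∀ b, ∃ a, c' b = φ (c a) := by
  have hg : PreservesBtw G (φ ∘ c) := fun x y z h => hφ.btw (preservesBtw_of_isGraphCube hc x y z h)
  refine hg.exists_factor fun i => hφ.dist_le_one ?_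
  rw [← SimpleGraph.dist_eq_one_iff_adj, hc, hammingDist_eq_sum,
    Finset.sum_eq_single i (by intro j _ hj; simp [hj]) (by simp)]
  simp

/-- The extension of a cubical vertex map to the cube complex. -/
noncomputable def map (hφ : IsCubical G φ) (x : CubeComplex G) : CubeComplex G :=
  ⟨x.1.mapDomain φ, by
    obtain ⟨n, c, s, hc, hs, hx⟩ := x.2
    obtain ⟨m, ι, c', hι, hc', h, -⟩ := hφ.exists_cube hc
    exact ⟨m, c', reindex ι s, hc', reindex_mem ι hs, by rw [hx, mapDomain_cubePoint hι h]⟩⟩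

theorem InCubeAtDist.map (hφ : IsCubical G φ) {x y : CubeComplex G} {r : ℝ}
    (h : InCubeAtDist G x y r) :
    ∃ r' ≤ r, InCubeAtDist G (CubeComplex.map hφ x) (CubeComplex.map hφ y) r' := by
  obtain ⟨n, c, s, t, hc, hs, ht, hx, hy, rfl⟩ := h
  obtain ⟨m, ι, c', hι, hc', h, -⟩ := hφ.exists_cube hc
  refine ⟨_, dist_reindex_le hι s t, m, c', reindex ι s, reindex ι t, hc', reindex_mem ι hs,
    reindex_mem ι ht, ?_, ?_, rfl⟩
  · rw [← mapDomain_cubePoint hι h, ← hx]; rfl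
  · rw [← mapDomain_cubePoint hι h, ← hy]; rfl

theorem PathOfLength.map (hφ : IsCubical G φ) {x y : CubeComplex G} {l : ℝ}
    (h : PathOfLength G x y l) :
    ∃ l' ≤ l, PathOfLength G (CubeComplex.map hφ x) (CubeComplex.map hφ y) l' := by
  induction h with
  | refl => exact ⟨0, le_rfl, .refl _⟩
  | snoc _ h ih =>
    obtain ⟨l', hl', h1⟩ := ih
    obtain ⟨r', hr', h2⟩ := h.map hφ
    exact ⟨l' + r', add_le_add hl' hr', h1.snoc h2⟩

theorem PathOfLength.dist_le {x y : CubeComplex G} {l : ℝ} (h : PathOfLength G x y l) :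
    dist x y ≤ l :=
  csInf_le (bddBelow_pathLengths x y) h

theorem exists_pathOfLength_lt (x y : CubeComplex G) {ε : ℝ} (hε : 0 < ε) :
    ∃ l, PathOfLength G x y l ∧ l < dist x y + ε :=
  exists_lt_of_csInf_lt (exists_path IsMedianGraph.connected x y)
    (lt_add_of_pos_right (dist x y) hε)

theorem dist_map_le (hφ : IsCubical G φ) (x y : CubeComplex G) :
    dist (map hφ x) (map hφ y) ≤ dist x y := by
  refine le_of_forall_pos_le_add fun ε hε => ?_
  obtain ⟨l, hl, hlt⟩ := exists_pathOfLength_lt x y hε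
  obtain ⟨l', hl', h⟩ := hl.map hφ
  exact (h.dist_le.trans hl').trans hlt.le

theorem map_vertex (hφ : IsCubical G φ) (v : V) : map hφ (vertex G v) = vertex G (φ v) :=
  Subtype.ext (by simp [map, vertex])

theorem dist_mk_le {n : ℕ} {c : (Fin n → Bool) → V} (hc : IsGraphCube G c) (s t : unitCube n) :
    dist (mk hc s) (mk hc t) ≤ dist s t :=
  (InCubeAtDist.path ⟨n, c, s, t, hc, s.2, t.2, rfl, rfl, rfl⟩).dist_le

theorem isCompact_unitCube (n : ℕ) : IsCompact (unitCube n) := by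
  have h : unitCube n = WithLp.toLp 2 '' (Set.univ.pi fun _ : Fin n => Set.Icc (0 : ℝ) 1) := by
    ext s
    constructor
    · intro hs
      exact ⟨WithLp.ofLp s, fun i _ => hs i, rfl⟩
    · rintro ⟨f, hf, rfl⟩ i
      exact hf i (Set.mem_univ i)
  rw [h]
  exact (isCompact_univ_pi fun _ => isCompact_Icc).image (PiLp.continuous_toLp 2 _)

theorem isCompact_range_mk {n : ℕ} {c : (Fin n → Bool) → V} (hc : IsGraphCube G c) :
    IsCompact (Set.range (mk hc)) := by
  have : CompactSpace (unitCube n) := isCompact_iff_compactSpace.mp (isCompact_unitCube n)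
  exact isCompact_range (LipschitzWith.of_dist_le_mul (K := 1)
    fun s t => by simpa using dist_mk_le hc s t).continuous

/-- The points in cubes with vertices in a given finite set form a compact set. -/
theorem isCompact_subcomplex {N : ℕ}
    (hN : ∀ (n : ℕ) (c : (Fin n → Bool) → V), IsGraphCube G c → n ≤ N) {F : Set V}
    (hF : F.Finite) :
    IsCompact {x : CubeComplex G | ∃ (n : ℕ) (c : (Fin n → Bool) → V) (hc : IsGraphCube G c),
      (∀ a, c a ∈ F) ∧ x ∈ Set.range (mk hc)} := by
  have : {x : CubeComplex G | ∃ (n : ℕ) (c : (Fin n → Bool) → V) (hc : IsGraphCube G c),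
      (∀ a, c a ∈ F) ∧ x ∈ Set.range (mk hc)} = ⋃ n ∈ Set.Iic N,
      ⋃ c ∈ {c : (Fin n → Bool) → V | (∀ a, c a ∈ F) ∧ IsGraphCube G c},
        {x | ∃ hc : IsGraphCube G c, x ∈ Set.range (mk hc)} := by
    ext x
    simp only [Set.mem_ofPred_eq, Set.mem_iUnion, Set.mem_Iic, exists_prop]
    constructor
    · rintro ⟨n, c, hc, hcF, hx⟩
      exact ⟨n, hN n c hc, c, ⟨hcF, hc⟩, hc, hx⟩
    · rintro ⟨n, -, c, ⟨hcF, hc⟩, _, hx⟩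
      exact ⟨n, c, hc, hcF, hx⟩
  rw [this]
  refine (Set.finite_Iic N).isCompact_biUnion fun n _ => ?_
  refine Set.Finite.isCompact_biUnion ?_ fun c hc => ?_
  · refine (Set.Finite.pi fun _ : Fin n → Bool => hF).subset ?_
    rintro c ⟨hc, -⟩ a -
    exact hc a
  · have h : {x | ∃ hc : IsGraphCube G c, x ∈ Set.range (mk hc)} = Set.range (mk hc.2) := by
      ext x
      exact ⟨fun ⟨_, h⟩ => h, fun h => ⟨hc.2, h⟩⟩
    rw [h]
    exact isCompact_range_mk hc.2

end CubeComplex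

/-! ### Comparing $d_2$ with the graph metric; paths as 1-Lipschitz curves. -/

namespace CubeComplex

open IsMedianGraph

variable {V : Type*} {G : SimpleGraph V}

theorem abs_prod_sub_prod_le {n : ℕ} (f g : Fin n → ℝ) (hf : ∀ i, |f i| ≤ 1)
    (hg : ∀ i, |g i| ≤ 1) : |∏ i, f i - ∏ i, g i| ≤ ∑ i, |f i - g i| := by
  induction n with
  | zero => simp
  | succ n ih =>
    rw [Fin.prod_univ_succ, Fin.prod_univ_succ, Fin.sum_univ_succ]
    have h1 := ih (fun i => f i.succ) (fun i => g i.succ) (fun i => hf _) (fun i => hg _)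
    have h2 : |∏ i : Fin n, g i.succ| ≤ 1 := by
      rw [Finset.abs_prod]
      exact Finset.prod_le_one (fun _ _ => abs_nonneg _) fun i _ => hg _
    calc |f 0 * ∏ i : Fin n, f i.succ - g 0 * ∏ i : Fin n, g i.succ|
        = |(f 0 - g 0) * ∏ i : Fin n, g i.succ
            + f 0 * (∏ i : Fin n, f i.succ - ∏ i : Fin n, g i.succ)| := by ring_nf
      _ ≤ |f 0 - g 0| * 1 + 1 * ∑ i : Fin n, |f i.succ - g i.succ| := by
          refine (abs_add_le _ _).trans (add_le_add ?_ ?_) <;> rw [abs_mul]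
          · exact mul_le_mul_of_nonneg_left h2 (abs_nonneg _)
          · exact mul_le_mul (hf 0) h1 (abs_nonneg _) zero_le_one
      _ = _ := by ring

theorem abs_weight_sub_le {n : ℕ} {s t : EuclideanSpace ℝ (Fin n)} (hs : s ∈ unitCube n)
    (ht : t ∈ unitCube n) (a : Fin n → Bool) : |weight s a - weight t a| ≤ n * dist s t := by
  have hle : ∀ {s : EuclideanSpace ℝ (Fin n)}, s ∈ unitCube n → ∀ i,
      |if a i then s i else 1 - s i| ≤ 1 := by
    intro s hs i
    obtain ⟨h0, h1⟩ := hs i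
    split_ifs <;> rw [abs_le] <;> constructor <;> linarith
  refine (abs_prod_sub_prod_le _ _ (hle hs) (hle ht)).trans ?_
  refine (Finset.sum_le_card_nsmul _ _ (dist s t) fun i _ => ?_).trans (by simp)
  have h1 : |s i - t i| ≤ dist s t := by
    rw [dist_eq_norm]
    simpa using PiLp.norm_apply_le (s - t) i
  split_ifs
  · exact h1
  · rw [abs_sub_comm] at h1
    simpa using h1

/-- The multilinear extension of the graph distance from `o`. -/
noncomputable def distFrom (o : V) (x : CubeComplex G) : ℝ :=
  Finsupp.linearCombination ℝ (fun v => (G.dist o v : ℝ)) x.1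

theorem distFrom_vertex (o v : V) : distFrom o (vertex G v) = G.dist o v := by
  simp [distFrom, vertex]

theorem distFrom_eq_sum (o : V) {x : CubeComplex G} {n : ℕ} {c : (Fin n → Bool) → V}
    {s : EuclideanSpace ℝ (Fin n)} (hx : x.1 = cubePoint c s) :
    distFrom o x = ∑ a, weight s a * G.dist o (c a) := by
  simp [distFrom, hx, cubePoint_eq, Finsupp.linearCombination_single]

variable [IsMedianGraph G] {N : ℕ}

theorem abs_dist_sub_dist_le (o u v : V) : |(G.dist o u : ℝ) - G.dist o v| ≤ G.dist u v := by
  have h1 : (G.dist o u : ℝ) ≤ G.dist o v + G.dist u v := by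
    rw [G.dist_comm (u := u)]
    exact_mod_cast IsMedianGraph.dist_triangle G o v u
  have h2 : (G.dist o v : ℝ) ≤ G.dist o u + G.dist u v := by
    exact_mod_cast IsMedianGraph.dist_triangle G o u v
  rw [abs_le]
  constructor <;> linarith

theorem InCubeAtDist.abs_distFrom_sub_le
    (hN : ∀ (n : ℕ) (c : (Fin n → Bool) → V), IsGraphCube G c → n ≤ N) (o : V)
    {x y : CubeComplex G} {r : ℝ} (h : InCubeAtDist G x y r) :
    |distFrom o x - distFrom o y| ≤ 2 ^ N * N * N * r := by
  obtain ⟨n, c, s, t, hc, hs, ht, hx, hy, rfl⟩ := h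
  have hn := hN n c hc
  -- Both weight families sum to 1, so a constant can be subtracted. This bounds the second factor
  -- by `n`; with `2 ^ n` corners and weight differences at most `n * dist s t` this gives the
  -- constant.
  have h0 : distFrom o x - distFrom o y = ∑ a, (weight s a - weight t a) *
      ((G.dist o (c a) : ℝ) - G.dist o (c fun _ => false)) := by
    rw [distFrom_eq_sum o hx, distFrom_eq_sum o hy]
    simp only [mul_sub, sub_mul, Finset.sum_sub_distrib, ← Finset.sum_mul, sum_weight]
    ring
  rw [h0]
  have hterm : ∀ a, |(weight s a - weight t a) *
      ((G.dist o (c a) : ℝ) - G.dist o (c fun _ => false))| ≤ n * dist s t * n := by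
    intro a
    rw [abs_mul]
    refine mul_le_mul (abs_weight_sub_le hs ht a) ?_ (abs_nonneg _) (by positivity)
    refine (abs_dist_sub_dist_le o _ _).trans ?_
    rw [hc]
    exact_mod_cast (hammingDist_le_card_fintype (x := a) (y := fun _ => false)).trans (by simp)
  refine (Finset.abs_sum_le_sum_abs _ _).trans
    ((Finset.sum_le_card_nsmul _ _ _ fun a _ => hterm a).trans ?_)
  simp only [Finset.card_univ, Fintype.card_pi, Fintype.card_bool, Finset.prod_const,
    Fintype.card_fin, nsmul_eq_mul, Nat.cast_pow, Nat.cast_ofNat]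
  calc (2 : ℝ) ^ n * (n * dist s t * n) = 2 ^ n * n * n * dist s t := by ring
    _ ≤ 2 ^ N * N * N * dist s t := by
      gcongr
      norm_num

theorem abs_distFrom_sub_le
    (hN : ∀ (n : ℕ) (c : (Fin n → Bool) → V), IsGraphCube G c → n ≤ N) (o : V)
    (x y : CubeComplex G) : |distFrom o x - distFrom o y| ≤ 2 ^ N * N * N * dist x y := by
  have hpath : ∀ {y : CubeComplex G} {l : ℝ}, PathOfLength G x y l →
      |distFrom o x - distFrom o y| ≤ 2 ^ N * N * N * l := by
    intro y l h
    induction h with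
    | refl => simp
    | snoc _ h ih =>
      rw [mul_add]
      exact (abs_sub_le _ _ _).trans (add_le_add ih (h.abs_distFrom_sub_le hN o))
  have hK : (0 : ℝ) ≤ 2 ^ N * N * N := by positivity
  have hmem : ∀ ε > 0, |distFrom o x - distFrom o y| ≤ 2 ^ N * N * N * (dist x y + ε) := by
    intro ε hε
    obtain ⟨l, hl, hlt⟩ := exists_pathOfLength_lt x y hε
    exact (hpath hl).trans (mul_le_mul_of_nonneg_left hlt.le hK)
  refine le_of_forall_pos_le_add fun ε hε => ?_
  have hK' : (0 : ℝ) < 2 ^ N * N * N + 1 := by positivity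
  have h1 := hmem (ε / (2 ^ N * N * N + 1)) (by positivity)
  have h2 : 2 ^ N * N * N * (ε / (2 ^ N * N * N + 1)) ≤ ε := by
    rw [← mul_div_assoc, div_le_iff₀ hK']
    nlinarith
  linarith

/-- The function `distFrom u` interpolates the graph distance and is Lipschitz for $d_2$. With
`dist_vertex_le`, the two metrics on vertices are bilipschitz equivalent. -/
theorem graphDist_le (hN : ∀ (n : ℕ) (c : (Fin n → Bool) → V), IsGraphCube G c → n ≤ N)
    (u v : V) : (G.dist u v : ℝ) ≤ 2 ^ N * N * N * dist (vertex G u) (vertex G v) := by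
  have := abs_distFrom_sub_le hN u (vertex G v) (vertex G u)
  rw [distFrom_vertex, distFrom_vertex, SimpleGraph.dist_self, dist_comm] at this
  simpa using this

theorem dist_vertex_le_one {u v : V} (h : G.Adj u v) : dist (vertex G u) (vertex G v) ≤ 1 := by
  have hc : IsGraphCube G (fun a : Fin 1 → Bool => if a 0 then v else u) := by
    have h1 : G.dist u v = 1 := SimpleGraph.dist_eq_one_iff_adj.mpr h
    have h2 : G.dist v u = 1 := SimpleGraph.dist_eq_one_iff_adj.mpr h.symm
    intro a b
    cases ha : a 0 <;> cases hb : b 0 <;>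
      simp [hammingDist, Finset.filter_singleton, ha, hb, h1, h2]
  have h3 : InCubeAtDist G (vertex G u) (vertex G v)
      (dist (corner (n := 1) fun _ => false) (corner fun _ => true)) := by
    refine ⟨1, _, corner fun _ => false, corner fun _ => true, hc, corner_mem _, corner_mem _,
      ?_, ?_, rfl⟩ <;> rw [cubePoint_corner] <;> simp [vertex]
  refine h3.path.dist_le.trans ?_
  rw [EuclideanSpace.dist_eq]
  simp [corner]

theorem dist_mk_vertex_le {n : ℕ} {c : (Fin n → Bool) → V} (hc : IsGraphCube G c)
    (s : unitCube n) (a : Fin n → Bool) : dist (mk hc s) (vertex G (c a)) ≤ n := by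
  have h : InCubeAtDist G (mk hc s) (vertex G (c a)) (dist (s : EuclideanSpace ℝ (Fin n))
      (corner a)) :=
    ⟨n, c, s, corner a, hc, s.2, corner_mem a, rfl, by rw [cubePoint_corner]; rfl, rfl⟩
  refine h.path.dist_le.trans ?_
  rw [EuclideanSpace.dist_eq, Real.sqrt_le_left (by positivity)]
  refine (Finset.sum_le_card_nsmul _ _ 1 fun i _ => ?_).trans ?_
  · obtain ⟨h0, h1⟩ := s.2 i
    obtain ⟨h2, h3⟩ := corner_mem a i
    rw [Real.dist_eq, sq_abs, sq_le_one_iff_abs_le_one, abs_le]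
    constructor <;> linarith
  · simp only [Finset.card_univ, Fintype.card_fin, nsmul_eq_mul, mul_one]
    exact_mod_cast Nat.le_self_pow two_ne_zero n

theorem convex_unitCube (n : ℕ) : Convex ℝ (unitCube n) := by
  intro s hs t ht a b ha hb hab i
  exact convex_Icc (0 : ℝ) 1 (hs i) (ht i) ha hb hab

theorem InCubeAtDist.exists_curve {x y : CubeComplex G} {r : ℝ} (h : InCubeAtDist G x y r) :
    0 ≤ r ∧ ∃ σ : ℝ → CubeComplex G, σ 0 = x ∧ σ r = y ∧ ∀ t t', dist (σ t) (σ t') ≤ |t - t'| := by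
  obtain ⟨n, c, s, t, hc, hs, ht, hx, hy, rfl⟩ := h
  -- Clamping to $[0,1]$ defines the segment for all real times; if `s = t`, the quotient is 0 and
  -- the curve is constant.
  refine ⟨dist_nonneg, fun τ => mk hc ⟨AffineMap.lineMap s t
    (Set.projIcc (0 : ℝ) 1 zero_le_one (τ / dist s t) : ℝ),
      (convex_unitCube n).lineMap_mem hs ht (Set.projIcc (0 : ℝ) 1 zero_le_one _).2⟩, ?_, ?_, ?_⟩
  · refine Subtype.ext ?_
    simp [mk, hx]
  · refine Subtype.ext ?_
    by_cases hst : s = t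
    · subst hst; simp [mk, hy]
    · simp [mk, hy, div_self (dist_ne_zero.mpr hst)]
  · intro τ τ'
    refine (dist_mk_le hc _ _).trans ?_
    rw [Subtype.dist_eq, dist_lineMap_lineMap, Real.dist_eq]
    rcases eq_or_lt_of_le (dist_nonneg (x := s) (y := t)) with h0 | h0
    · rw [← h0]; simp
    · calc _ ≤ |τ / dist s t - τ' / dist s t| * dist s t :=
            mul_le_mul_of_nonneg_right (Set.abs_projIcc_sub_projIcc _) dist_nonneg
        _ = |τ - τ'| := by
            rw [← sub_div, abs_div, abs_of_pos h0, div_mul_cancel₀ _ h0.ne']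

/-- A piecewise linear path can be parametrised by arc length. -/
theorem PathOfLength.exists_curve {x y : CubeComplex G} {l : ℝ} (h : PathOfLength G x y l) :
    ∃ γ : ℝ → CubeComplex G, γ 0 = x ∧ γ l = y ∧
      ∀ t ∈ Set.Icc 0 l, ∀ t' ∈ Set.Icc 0 l, dist (γ t) (γ t') ≤ |t - t'| := by
  induction h with
  | refl => exact ⟨fun _ => x, rfl, rfl, fun t _ t' _ => by simp⟩
  | @snoc y z l r hp hc ih =>
    obtain ⟨γ, h0, h1, hγ⟩ := ih
    obtain ⟨hr, σ, s0, s1, hσ⟩ := hc.exists_curve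
    have hl := hp.nonneg
    refine ⟨fun t => if t ≤ l then γ t else σ (t - l), by simp [hl, h0], ?_, ?_⟩
    · dsimp only
      split_ifs with hrl
      · have : r = 0 := by linarith
        subst this
        rw [add_zero, h1, ← s0, s1]
      · rw [add_sub_cancel_left, s1]
    · suffices H : ∀ t ∈ Set.Icc 0 (l + r), ∀ t' ∈ Set.Icc 0 (l + r), t ≤ t' →
          dist (if t ≤ l then γ t else σ (t - l)) (if t' ≤ l then γ t' else σ (t' - l))
            ≤ |t - t'| by
        intro t ht t' ht'
        rcases le_total t t' with h | h
        · exact H t ht t' ht' h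
        · rw [dist_comm, abs_sub_comm]
          exact H t' ht' t ht h
      rintro t ⟨ht0, ht1⟩ t' ⟨ht0', ht1'⟩ htt
      by_cases h2 : t' ≤ l
      · rw [if_pos (htt.trans h2), if_pos h2]
        exact hγ t ⟨ht0, htt.trans h2⟩ t' ⟨ht0', h2⟩
      · rw [if_neg h2]
        by_cases h3 : t ≤ l
        · rw [if_pos h3]
          have e1 := hγ t ⟨ht0, h3⟩ l ⟨hl, le_rfl⟩
          have e2 := hσ 0 (t' - l)
          rw [h1] at e1
          rw [s0] at e2
          refine (_root_.dist_triangle _ y _).trans ((add_le_add e1 e2).trans ?_)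
          rw [abs_of_nonpos (by linarith), abs_of_nonpos (by linarith),
            abs_of_nonpos (by linarith)]
          linarith
        · rw [if_neg h3]
          refine (hσ _ _).trans (le_of_eq ?_)
          congr 1
          ring

end CubeComplex

/-! ### Chains along a quasiline, and limits of almost geodesics. -/

open Filter Topology

/-- A chain of points with small steps joining points near `f a` and `f b` passes near `f k`,
for a quasiisometry `f` from a subset of the line and `a ≤ k ≤ b`. -/
theorem exists_chain_dist_le {M : Type*} [PseudoMetricSpace M] {S : Set ℝ} {f : S → M}
    (hf : IsQuasiIsometry f) (D : ℝ) :
    ∃ R, ∀ (a k b : S) (g : ℕ → M) (L : ℕ), a ≤ k → k ≤ b →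
      (∀ l < L, dist (g l) (g (l + 1)) ≤ 1) → dist (g 0) (f a) ≤ D → dist (g L) (f b) ≤ D →
      ∃ l ≤ L, dist (g l) (f k) ≤ R := by
  obtain ⟨q, hq, hqi, hdense⟩ := hf
  choose τ hτ using hdense
  have hq0 : 0 < q := by linarith
  have hback : ∀ s t : S, |(s : ℝ) - t| ≤ q * (dist (f s) (f t) + q) := by
    intro s t
    have h := (hqi s t).1
    have h' : q⁻¹ * dist s t ≤ dist (f s) (f t) + q := by linarith
    rw [inv_mul_le_iff₀ hq0] at h'
    exact h'
  have hclose : ∀ (x : M) (t : S) (e : ℝ), dist x (f t) ≤ e →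
      |(τ x : ℝ) - t| ≤ q * (2 * q + e) := by
    intro x t e he
    refine (hback _ _).trans (mul_le_mul_of_nonneg_left ?_ hq0.le)
    linarith [dist_triangle (f (τ x)) x (f t), hτ x]
  have hstep : ∀ x y : M, dist x y ≤ 1 → |(τ x : ℝ) - τ y| ≤ q * (3 * q + 1) := by
    intro x y hxy
    refine (hclose x (τ y) (1 + q) ?_).trans (le_of_eq (by ring))
    linarith [dist_triangle x y (f (τ y)), hτ y, dist_comm y (f (τ y))]
  -- `E` bounds both the jump of the coarse inverse `τ` over one step of the chain and its error at
  -- the two ends; `|D|` is used because `D` may be negative.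
  set E : ℝ := q * (3 * q + 1 + |D|) with hE
  have hE1 : q * (3 * q + 1) ≤ E := mul_le_mul_of_nonneg_left (by linarith [abs_nonneg D]) hq0.le
  have hE2 : q * (2 * q + D) ≤ E := mul_le_mul_of_nonneg_left (by linarith [le_abs_self D]) hq0.le
  refine ⟨q + (q * E + q), fun a k b g L hak hkb hg h0 hL => ?_⟩
  have hak' : (a : ℝ) ≤ k := hak
  have hkb' : (k : ℝ) ≤ b := hkb
  suffices H : ∃ l ≤ L, |(τ (g l) : ℝ) - k| ≤ E by
    obtain ⟨l, hl, hlk⟩ := H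
    refine ⟨l, hl, ?_⟩
    have h1 := (hqi (τ (g l)) k).2
    have h2 : q * dist (τ (g l)) k ≤ q * E := mul_le_mul_of_nonneg_left hlk hq0.le
    linarith [dist_triangle (g l) (f (τ (g l))) (f k), hτ (g l), dist_comm (g l) (f (τ (g l)))]
  classical
  -- Discrete intermediate value argument: the first index past `k` overshoots by at most one jump.
  -- If there is none, the last point is below `k` yet close to `b ≥ k`.
  by_cases hex : ∃ l, l ≤ L ∧ (k : ℝ) ≤ τ (g l)
  · obtain ⟨hlL, hlk⟩ := Nat.find_spec hex
    have hmin := fun m => Nat.find_min hex (m := m)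
    generalize Nat.find hex = l at *
    refine ⟨l, hlL, ?_⟩
    rw [abs_of_nonneg (by linarith)]
    cases l with
    | zero =>
      have := (abs_le.mp (hclose _ _ _ h0)).2
      linarith
    | succ m =>
      have h1 : ¬ (m ≤ L ∧ (k : ℝ) ≤ τ (g m)) := hmin m (Nat.lt_succ_self m)
      have h2 : (τ (g m) : ℝ) < k := by
        by_contra hge
        exact h1 ⟨by omega, not_lt.mp hge⟩
      have := (abs_le.mp (hstep _ _ (hg m (by omega)))).1
      linarith
  · refine ⟨L, le_rfl, ?_⟩
    have h1 : (τ (g L) : ℝ) < k := by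
      by_contra hge
      exact hex ⟨L, le_rfl, not_lt.mp hge⟩
    rw [abs_of_nonpos (by linarith)]
    have := (abs_le.mp (hclose _ _ _ hL)).1
    linarith

/-- A pointwise limit of almost isometric maps with values in compact sets. -/
theorem exists_isometric_limit {M : Type*} [PseudoMetricSpace M] {J : Set ℝ} (δ : ℕ → ℝ → M)
    (hK : ∀ t ∈ J, ∃ K : Set M, IsCompact K ∧ ∀ᶠ n in atTop, δ n t ∈ K)
    (hd : ∀ s ∈ J, ∀ t ∈ J, Tendsto (fun n => dist (δ n s) (δ n t)) atTop (𝓝 |s - t|)) :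
    ∃ γ : J → M, Isometry γ := by
  -- One ultrafilter gives limits at all times simultaneously, so no diagonal subsequence is needed.
  have hle : (hyperfilter ℕ : Filter ℕ) ≤ atTop := Nat.hyperfilter_le_atTop
  have hlim : ∀ t : J, ∃ x, Tendsto (fun n => δ n t) (hyperfilter ℕ) (𝓝 x) := by
    intro t
    obtain ⟨K, hKc, hev⟩ := hK t t.2
    obtain ⟨x, -, hx⟩ := hKc.ultrafilter_le_nhds ((hyperfilter ℕ).map fun n => δ n t)
      (le_principal_iff.mpr (hle hev))
    exact ⟨x, hx⟩
  choose γ hγ using hlim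
  refine ⟨γ, Isometry.of_dist_eq fun s t => ?_⟩
  exact tendsto_nhds_unique ((hγ s).dist (hγ t)) ((hd s s.2 t t.2).mono_left hle)

/-- A sequence of almost geodesics through a bounded set, with values in a subset whose
bounded parts are relatively compact, yields an isometric embedding. -/
theorem exists_isometric_of_almost_geodesics {M : Type*} [PseudoMetricSpace M] {J : Set ℝ}
    {Z : Set M} {x₀ : M} {R : ℝ}
    (hZ : ∀ r, ∃ K : Set M, IsCompact K ∧ ∀ z ∈ Z, dist z x₀ ≤ r → z ∈ K)
    (δ : ℕ → ℝ → M) (lo hi : ℕ → ℝ) (h0 : ∀ n, 0 ∈ Set.Icc (lo n) (hi n))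
    (hJ : ∀ t ∈ J, ∀ᶠ n in atTop, t ∈ Set.Icc (lo n) (hi n)) (hδZ : ∀ n t, δ n t ∈ Z)
    (hδ0 : ∀ n, dist (δ n 0) x₀ ≤ R)
    (hlip : ∀ n, ∀ s ∈ Set.Icc (lo n) (hi n), ∀ t ∈ Set.Icc (lo n) (hi n),
      dist (δ n s) (δ n t) ≤ |s - t|)
    (hgeo : ∀ n, hi n - lo n ≤ dist (δ n (lo n)) (δ n (hi n)) + 1 / ((n : ℝ) + 1)) :
    ∃ γ : J → M, Isometry γ := by
  refine exists_isometric_limit δ (fun t ht => ?_) (fun s hs t ht => ?_)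
  · obtain ⟨K, hK, hmem⟩ := hZ (|t| + R)
    refine ⟨K, hK, (hJ t ht).mono fun n hn => hmem _ (hδZ n t) ?_⟩
    have := hlip n t hn 0 (h0 n)
    rw [sub_zero] at this
    linarith [dist_triangle (δ n t) (δ n 0) x₀, hδ0 n]
  -- The whole curve loses at most `1 / (n + 1)` against the distance of its ends, hence so does
  -- every piece.
  · have hlow : ∀ n, ∀ s ∈ Set.Icc (lo n) (hi n), ∀ t ∈ Set.Icc (lo n) (hi n), s ≤ t →
        |s - t| - 1 / ((n : ℝ) + 1) ≤ dist (δ n s) (δ n t) := by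
      intro n s hs t ht hst
      have hlo : lo n ∈ Set.Icc (lo n) (hi n) := ⟨le_rfl, (h0 n).1.trans (h0 n).2⟩
      have hhi : hi n ∈ Set.Icc (lo n) (hi n) := ⟨(h0 n).1.trans (h0 n).2, le_rfl⟩
      have e1 := hlip n _ hlo s hs
      have e2 := hlip n t ht _ hhi
      rw [abs_of_nonpos (by linarith [hs.1])] at e1
      rw [abs_of_nonpos (by linarith [ht.2])] at e2
      rw [abs_of_nonpos (by linarith)]
      linarith [hgeo n, dist_triangle (δ n (lo n)) (δ n s) (δ n (hi n)),
        dist_triangle (δ n s) (δ n t) (δ n (hi n))]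
    have htend : Tendsto (fun n : ℕ => |s - t| - 1 / ((n : ℝ) + 1)) atTop (𝓝 |s - t|) := by
      simpa using tendsto_const_nhds.sub (tendsto_one_div_add_atTop_nhds_zero_nat (𝕜 := ℝ))
    refine tendsto_of_tendsto_of_tendsto_of_le_of_le' htend tendsto_const_nhds ?_ ?_
    · filter_upwards [hJ s hs, hJ t ht] with n h1 h2
      rcases le_total s t with h | h
      · exact hlow n s h1 t h2 h
      · rw [abs_sub_comm, dist_comm]
        exact hlow n t h2 s h1 h
    · filter_upwards [hJ s hs, hJ t ht] with n h1 h2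
      exact hlip n s h1 t h2

/-! ### Medians as nearest points on intervals. -/

namespace IsMedianGraph

variable {V : Type*} {G : SimpleGraph V} [IsMedianGraph G]

theorem exists_geodesic (x y : V) : ∃ v : ℕ → V, v 0 = x ∧ v (G.dist x y) = y ∧
    (∀ l < G.dist x y, G.Adj (v l) (v (l + 1))) ∧ ∀ l ≤ G.dist x y, Btw G x (v l) y := by
  obtain ⟨w, hw⟩ := (connected (G := G)).exists_walk_length_eq_dist x y
  refine ⟨w.getVert, w.getVert_zero, hw ▸ w.getVert_length,
    fun l hl => w.adj_getVert_succ (hw ▸ hl), fun l hl => ?_⟩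
  have h1 := SimpleGraph.dist_le (w.take l)
  have h2 := SimpleGraph.dist_le (w.drop l)
  have h3 := dist_triangle G x (w.getVert l) y
  rw [w.take_length] at h1
  rw [w.drop_length] at h2
  unfold Btw
  omega

/-- The distance from `k` to the median is $\frac12(d(a,k)+d(k,b)-d(a,b))$, and the detour through
`v` bounds this by $d(v,k)$. -/
theorem dist_med_le_dist_of_btw {a b k v : V} (h : Btw G a v b) :
    G.dist k (med G a k b) ≤ G.dist v k := by
  have e1 := btw_med_left (G := G) a k b
  have e2 := btw_med_right (G := G) a k b
  have e3 := btw_med_outer (G := G) a k b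
  have t1 := dist_triangle G a v k
  have t2 := dist_triangle G k v b
  generalize med G a k b = m at *
  have c1 := G.dist_comm (u := k) (v := m)
  have c2 := G.dist_comm (u := k) (v := v)
  unfold Btw at *
  omega

/-- The same formula, half of $d(a,x)+d(x,b)-d(a,b)$, is 1-Lipschitz in $x$. -/
theorem dist_med_le_add (a b x y : V) :
    G.dist x (med G a x b) ≤ G.dist x y + G.dist y (med G a y b) := by
  have e1 := btw_med_left (G := G) a x b
  have e2 := btw_med_right (G := G) a x b
  have e3 := btw_med_outer (G := G) a x b
  have f1 := btw_med_left (G := G) a y b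
  have f2 := btw_med_right (G := G) a y b
  have f3 := btw_med_outer (G := G) a y b
  have t1 := dist_triangle G a y x
  have t2 := dist_triangle G x y b
  generalize med G a x b = m at *
  generalize med G a y b = n at *
  have c1 := G.dist_comm (u := x) (v := m)
  have c2 := G.dist_comm (u := y) (v := n)
  have c3 := G.dist_comm (u := x) (v := y)
  unfold Btw at *
  omega

end IsMedianGraph

/-! ### The retraction of a quasiline, and the two cases of the theorem. -/

namespace CubeComplex

open IsMedianGraph

variable {V : Type*} {G : SimpleGraph V} [IsMedianGraph G] {N : ℕ}

theorem dist_vertex_le (u v : V) : dist (vertex G u) (vertex G v) ≤ G.dist u v := by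
  obtain ⟨w, w0, w1, hadj, -⟩ := exists_geodesic (G := G) u v
  have h := dist_le_range_sum_of_dist_le (f := fun l => vertex G (w l)) (d := fun _ => 1)
    (G.dist u v) fun hl => dist_vertex_le_one (hadj _ hl)
  simpa [w0, w1] using h

/-- A graph geodesic from `p a` to `p b` is a chain with unit steps, so it passes near `f k`; the
median is at least as near to `p k` as any of its points. -/
theorem exists_med_bound (hN : ∀ (n : ℕ) (c : (Fin n → Bool) → V), IsGraphCube G c → n ≤ N)
    {S : Set ℝ} {f : S → CubeComplex G} (hf : IsQuasiIsometry f) {p : S → V} {D : ℝ}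
    (hp : ∀ t, dist (vertex G (p t)) (f t) ≤ D) :
    ∃ R : ℕ, ∀ a k b : S, a ≤ k → k ≤ b → G.dist (p k) (med G (p a) (p k) (p b)) ≤ R := by
  obtain ⟨R, hR⟩ := exists_chain_dist_le hf D
  refine ⟨⌈2 ^ N * N * N * (R + D)⌉₊, fun a k b hak hkb => ?_⟩
  obtain ⟨v, v0, v1, hadj, hbtw⟩ := exists_geodesic (G := G) (p a) (p b)
  obtain ⟨l, hl, hlk⟩ := hR a k b (fun l => vertex G (v l)) _ hak hkb
    (fun l hl => dist_vertex_le_one (hadj l hl)) (by rw [v0]; exact hp a) (by rw [v1]; exact hp b)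
  refine (dist_med_le_dist_of_btw (hbtw l hl)).trans ?_
  have h1 := graphDist_le hN (v l) (p k)
  have h2 : dist (vertex G (v l)) (vertex G (p k)) ≤ R + D := by
    linarith [_root_.dist_triangle (vertex G (v l)) (f k) (vertex G (p k)), hp k,
      dist_comm (vertex G (p k)) (f k)]
  exact_mod_cast (h1.trans (mul_le_mul_of_nonneg_left h2 (by positivity))).trans (Nat.le_ceil _)

/-- If an idempotent cubical vertex map has only finitely many fixed vertices in each ball, then
its extension to the complex has an image with relatively compact bounded parts. -/
theorem exists_isCompact_of_finite_ball
    (hN : ∀ (n : ℕ) (c : (Fin n → Bool) → V), IsGraphCube G c → n ≤ N) {φ : V → V}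
    (hφ : IsCubical G φ) (hidem : ∀ v, φ (φ v) = φ v)
    (hfin : ∀ o, φ o = o → ∀ R : ℕ, {y | φ y = y ∧ G.dist o y ≤ R}.Finite)
    (x₀ : CubeComplex G) (r : ℝ) :
    ∃ K : Set (CubeComplex G), IsCompact K ∧ ∀ z ∈ Set.range (map hφ), dist z x₀ ≤ r → z ∈ K := by
  obtain ⟨v⟩ := (connected (G := G)).nonempty
  -- The radius is chosen so that the ball about the fixed vertex `φ v` contains all corners of an
  -- image cube that meets the `r`-ball about `x₀`.
  refine ⟨_, isCompact_subcomplex hN (hfin (φ v) (hidem v)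
    ⌈2 ^ N * N * N * (dist (vertex G (φ v)) x₀ + r + N)⌉₊), ?_⟩
  rintro z ⟨x, rfl⟩ hz
  obtain ⟨n, c, hc, s, rfl⟩ := exists_mk_eq x
  obtain ⟨m, ι, c', hι, hc', h, hc'φ⟩ := hφ.exists_cube hc
  have hmk : map hφ (mk hc s) = mk hc' ⟨reindex ι s, reindex_mem ι s.2⟩ :=
    Subtype.ext (mapDomain_cubePoint hι h s)
  refine ⟨m, c', hc', fun b => ⟨?_, ?_⟩, _, hmk.symm⟩
  · obtain ⟨a, ha⟩ := hc'φ b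
    rw [ha, hidem]
  · have h1 := graphDist_le hN (φ v) (c' b)
    have h2 := dist_mk_vertex_le hc' ⟨reindex ι s, reindex_mem ι s.2⟩ b
    rw [← hmk] at h2
    have h3 : (m : ℝ) ≤ N := by exact_mod_cast hN m c' hc'
    have h4 : dist (vertex G (φ v)) (vertex G (c' b)) ≤ dist (vertex G (φ v)) x₀ + r + N := by
      linarith [_root_.dist_triangle (vertex G (φ v)) x₀ (vertex G (c' b)),
        _root_.dist_triangle x₀ (map hφ (mk hc s)) (vertex G (c' b)),
        dist_comm x₀ (map hφ (mk hc s))]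
    exact_mod_cast (h1.trans (mul_le_mul_of_nonneg_left h4 (by positivity))).trans (Nat.le_ceil _)

/-- A finite-dimensional complex quasiisometric to a subset `S` of the line retracts by a
1-Lipschitz map to a coarsely dense subcomplex with relatively compact bounded parts. -/
theorem exists_retraction (hdim : FiniteDimensional G) {S : Set ℝ} {f : S → CubeComplex G}
    (hf : IsQuasiIsometry f) {α β : ℕ → S} (hα : ∀ k, ∀ᶠ n in atTop, α n ≤ k)
    (hβ : ∀ k, ∀ᶠ n in atTop, k ≤ β n) :
    ∃ Φ : CubeComplex G → CubeComplex G, (∀ x y, dist (Φ x) (Φ y) ≤ dist x y) ∧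
      (∃ C, ∀ k, ∃ y, Φ y = y ∧ dist y (f k) ≤ C) ∧
      ∀ x₀ r, ∃ K : Set (CubeComplex G), IsCompact K ∧
        ∀ z ∈ Set.range Φ, dist z x₀ ≤ r → z ∈ K := by
  obtain ⟨N, hN⟩ := hdim
  have hnear : ∀ t, ∃ v, dist (vertex G v) (f t) ≤ N := by
    intro t
    obtain ⟨n, c, hc, s, hs⟩ := exists_mk_eq (f t)
    refine ⟨c fun _ => false, ?_⟩
    rw [hs, dist_comm]
    exact (dist_mk_vertex_le hc s _).trans (by exact_mod_cast hN n c hc)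
  choose p hp using hnear
  obtain ⟨R, hR⟩ := exists_med_bound hN hf hp
  have hle : (hyperfilter ℕ : Filter ℕ) ≤ atTop := Nat.hyperfilter_le_atTop
  let 𝒜 : Ultrafilter V := (hyperfilter ℕ).map fun n => p (α n)
  let ℬ : Ultrafilter V := (hyperfilter ℕ).map fun n => p (β n)
  have hk : ∀ k, ∀ᶠ a in 𝒜, ∀ᶠ b in ℬ, G.dist (p k) (med G a (p k) b) ≤ R := by
    intro k
    change ∀ᶠ i in (hyperfilter ℕ : Filter ℕ), ∀ᶠ j in (hyperfilter ℕ : Filter ℕ),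
      G.dist (p k) (med G (p (α i)) (p k) (p (β j))) ≤ R
    filter_upwards [hle (hα k)] with i hi
    filter_upwards [hle (hβ k)] with j hj
    exact hR _ _ _ hi hj
  have hex : ∀ x, ∃ y, IsEndMedian G 𝒜 ℬ x y ∧
      ∀ R : ℕ, (∀ᶠ a in 𝒜, ∀ᶠ b in ℬ, G.dist x (med G a x b) ≤ R) → G.dist x y ≤ R := by
    intro x
    -- For arbitrary `x` the bound may depend on `x`; only for the vertices `p k` is the uniform `R`
    -- needed, and `hφR` recovers it.
    refine exists_isEndMedian hN 𝒜 ℬ (R := G.dist x (p (α 0)) + R) ?_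
    filter_upwards [hk (α 0)] with a ha
    filter_upwards [ha] with b hb
    exact (dist_med_le_add a b x (p (α 0))).trans (Nat.add_le_add_left hb _)
  choose φ hφ hφR using hex
  have hcub : IsCubical G φ := ⟨endMedian_btw hφ, endMedian_dist_le_one hφ⟩
  refine ⟨map hcub, dist_map_le hcub, ⟨R + N, fun k => ⟨vertex G (φ (p k)), ?_, ?_⟩⟩,
    exists_isCompact_of_finite_ball hN hcub (endMedian_idem hφ)
      fun o ho R => endMedian_finite_ball hφ hN ho R⟩
  · rw [map_vertex, endMedian_idem hφ]
  · have h1 := dist_vertex_le (G := G) (φ (p k)) (p k)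
    have h2 : (G.dist (φ (p k)) (p k) : ℝ) ≤ R := by
      rw [G.dist_comm]
      exact_mod_cast hφR (p k) R (hk k)
    linarith [_root_.dist_triangle (vertex G (φ (p k))) (vertex G (p k)) (f k), hp k]

/-- In the image of a 1-Lipschitz map `Φ`, fixed points are joined by almost geodesics. -/
theorem exists_almost_geodesic_of_retraction {Φ : CubeComplex G → CubeComplex G}
    (hΦ : ∀ x y, dist (Φ x) (Φ y) ≤ dist x y) {x y : CubeComplex G} (hx : Φ x = x) (hy : Φ y = y)
    {ε : ℝ} (hε : 0 < ε) :
    ∃ (l : ℝ) (γ : ℝ → CubeComplex G), 0 ≤ l ∧ l ≤ dist x y + ε ∧ γ 0 = x ∧ γ l = y ∧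
      (∀ t, γ t ∈ Set.range Φ) ∧
      ∀ t ∈ Set.Icc 0 l, ∀ t' ∈ Set.Icc 0 l, dist (γ t) (γ t') ≤ |t - t'| := by
  obtain ⟨l, hl, hlt⟩ := exists_pathOfLength_lt x y hε
  obtain ⟨γ, h0, h1, hγ⟩ := hl.exists_curve
  exact ⟨l, Φ ∘ γ, hl.nonneg, hlt.le, by simp [h0, hx], by simp [h1, hy],
    fun t => Set.mem_range_self _, fun t ht t' ht' => (hΦ _ _).trans (hγ t ht t' ht')⟩

theorem tendsto_dist_atTop {M : Type*} [PseudoMetricSpace M] {S : Set ℝ} {f : S → M}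
    (hf : IsQuasiIsometry f) {α : ℕ → S} (k : S)
    (hα : Tendsto (fun n => dist (α n) k) atTop atTop) {y : ℕ → M} {C : ℝ}
    (hy : ∀ n, dist (y n) (f (α n)) ≤ C) (x : M) :
    Tendsto (fun n => dist (y n) x) atTop atTop := by
  obtain ⟨q, hq, hqi, -⟩ := hf
  have h1 : Tendsto (fun n => q⁻¹ * dist (α n) k + (- q - C - dist x (f k))) atTop atTop :=
    tendsto_atTop_add_const_right _ _ (hα.const_mul_atTop (by positivity))
  refine tendsto_atTop_mono (fun n => ?_) h1
  linarith [(hqi (α n) k).1, hy n, dist_triangle4 (f (α n)) (y n) x (f k),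
    dist_comm (f (α n)) (y n)]

theorem exists_isometry_real (hdim : FiniteDimensional G)
    (h : QuasiIsometric ℝ (CubeComplex G)) : ∃ γ : ℝ → CubeComplex G, Isometry γ := by
  obtain ⟨f₀, hf₀⟩ := h
  let f : ↥(Set.univ : Set ℝ) → CubeComplex G := fun t => f₀ t
  have hf : IsQuasiIsometry f := by
    obtain ⟨q, hq, h1, h2⟩ := hf₀
    exact ⟨q, hq, fun s t => h1 s t, fun y => (h2 y).imp' (fun t => ⟨t, trivial⟩) fun _ h => h⟩
  let α : ℕ → (Set.univ : Set ℝ) := fun n => ⟨-(n : ℝ), trivial⟩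
  let β : ℕ → (Set.univ : Set ℝ) := fun n => ⟨(n : ℝ), trivial⟩
  let o : (Set.univ : Set ℝ) := ⟨0, trivial⟩
  have hα : ∀ k, ∀ᶠ n in atTop, α n ≤ k := fun k =>
    (tendsto_neg_atTop_atBot.comp tendsto_natCast_atTop_atTop).eventually_le_atBot (k : ℝ)
  have hβ : ∀ k, ∀ᶠ n in atTop, k ≤ β n := fun k =>
    tendsto_natCast_atTop_atTop.eventually_ge_atTop (k : ℝ)
  obtain ⟨Φ, hΦ, ⟨C, hC⟩, hK⟩ := exists_retraction hdim hf hα hβ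
  choose y hyΦ hy using hC
  obtain ⟨R, hR⟩ := exists_chain_dist_le hf C
  have hcurve : ∀ n : ℕ, ∃ (δ : ℝ → CubeComplex G) (lo hi : ℝ), 0 ∈ Set.Icc lo hi ∧
      δ lo = y (α n) ∧ δ hi = y (β n) ∧ (∀ t, δ t ∈ Set.range Φ) ∧ dist (δ 0) (f o) ≤ R ∧
      (∀ s ∈ Set.Icc lo hi, ∀ t ∈ Set.Icc lo hi, dist (δ s) (δ t) ≤ |s - t|) ∧
      hi - lo ≤ dist (δ lo) (δ hi) + 1 / ((n : ℝ) + 1) := by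
    intro n
    obtain ⟨l, γ, hl, hlt, h0, h1, hγΦ, hγ⟩ := exists_almost_geodesic_of_retraction hΦ
      (hyΦ (α n)) (hyΦ (β n)) (Nat.one_div_pos_of_nat (α := ℝ) (n := n))
    have hmem : ∀ i : ℕ, min (i : ℝ) l ∈ Set.Icc 0 l := fun i =>
      ⟨le_min (Nat.cast_nonneg i) hl, min_le_right _ _⟩
    -- Sampling the curve at integer times, stopped at `l`, gives a unit-step chain. It has a point
    -- near `f o`, whose time becomes the new origin of the parameter.
    obtain ⟨i, -, hi⟩ := hR (α n) o (β n) (fun i => γ (min (i : ℝ) l)) ⌈l⌉₊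
      (show -(n : ℝ) ≤ 0 by simp) (show (0 : ℝ) ≤ n by simp)
      (fun i _ => by
        refine (hγ _ (hmem i) _ (hmem (i + 1))).trans ((abs_min_sub_min_le_max _ _ _ _).trans ?_)
        simp)
      (by simpa [hl, h0] using hy (α n))
      (by simpa [min_eq_right (Nat.le_ceil l), h1] using hy (β n))
    obtain ⟨hτ0, hτ1⟩ := hmem i
    generalize min (i : ℝ) l = τ at *
    refine ⟨fun t => γ (τ + t), -τ, l - τ, ⟨by linarith, by linarith⟩, by simp [h0], by simp [h1],
      fun t => hγΦ _, by simpa using hi, ?_, ?_⟩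
    · rintro s ⟨hs0, hs1⟩ t ⟨ht0, ht1⟩
      refine (hγ _ ⟨by linarith, by linarith⟩ _ ⟨by linarith, by linarith⟩).trans (le_of_eq ?_)
      congr 1
      ring
    · simp only [add_neg_cancel, add_sub_cancel, h0, h1]
      linarith
  choose δ lo hi hmem hlo hhi hδΦ hδ0 hlip hgeo using hcurve
  -- The ends of the curves escape while time 0 stays near `f o`, so the parameter intervals exhaust
  -- the line.
  have hlo_lim : Tendsto (fun n => -lo n) atTop atTop := by
    have hα' : Tendsto (fun n => dist (α n) o) atTop atTop := by
      simpa [α, o, Subtype.dist_eq] using tendsto_natCast_atTop_atTop (R := ℝ)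
    refine tendsto_atTop_mono (fun n => ?_) (tendsto_atTop_add_const_right _ (-R)
      (tendsto_dist_atTop hf o hα' (fun n => hy (α n)) (f o)))
    have h1 := hlip n (lo n) ⟨le_rfl, (hmem n).1.trans (hmem n).2⟩ 0 (hmem n)
    rw [hlo, sub_zero, abs_of_nonpos (hmem n).1] at h1
    linarith [_root_.dist_triangle (y (α n)) (δ n 0) (f o), hδ0 n]
  have hhi_lim : Tendsto hi atTop atTop := by
    have hβ' : Tendsto (fun n => dist (β n) o) atTop atTop := by
      simpa [β, o, Subtype.dist_eq] using tendsto_natCast_atTop_atTop (R := ℝ)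
    refine tendsto_atTop_mono (fun n => ?_) (tendsto_atTop_add_const_right _ (-R)
      (tendsto_dist_atTop hf o hβ' (fun n => hy (β n)) (f o)))
    have h1 := hlip n (hi n) ⟨(hmem n).1.trans (hmem n).2, le_rfl⟩ 0 (hmem n)
    rw [hhi, sub_zero, abs_of_nonneg (hmem n).2] at h1
    linarith [_root_.dist_triangle (y (β n)) (δ n 0) (f o), hδ0 n]
  obtain ⟨γ, hγ⟩ := exists_isometric_of_almost_geodesics (J := Set.univ) (hK (f o)) δ lo hi hmem
    (fun t _ => by
      filter_upwards [hlo_lim.eventually_ge_atTop (-t), hhi_lim.eventually_ge_atTop t] with n h1 h2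
      exact ⟨neg_le_neg_iff.mp h1, h2⟩) hδΦ hδ0 hlip hgeo
  exact ⟨fun t => γ ⟨t, trivial⟩, fun s t => hγ _ _⟩

theorem exists_isometry_Ici (hdim : FiniteDimensional G)
    (h : QuasiIsometric (Set.Ici (0 : ℝ)) (CubeComplex G)) :
    ∃ γ : Set.Ici (0 : ℝ) → CubeComplex G, Isometry γ := by
  obtain ⟨f, hf⟩ := h
  let o : Set.Ici (0 : ℝ) := ⟨0, Set.self_mem_Ici⟩
  let β : ℕ → Set.Ici (0 : ℝ) := fun n => ⟨(n : ℝ), Set.mem_Ici.mpr (Nat.cast_nonneg n)⟩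
  have hβ : ∀ k, ∀ᶠ n in atTop, k ≤ β n := fun k =>
    tendsto_natCast_atTop_atTop.eventually_ge_atTop (k : ℝ)
  obtain ⟨Φ, hΦ, ⟨C, hC⟩, hK⟩ := exists_retraction hdim hf
    -- The origin is the least element, so a constant sequence serves as the left end; all curves
    -- then start at `y o` and need no recentring.
    (α := fun _ => o) (fun k => Eventually.of_forall fun _ => k.2) hβ
  choose y hyΦ hy using hC
  have hcurve := fun n : ℕ => exists_almost_geodesic_of_retraction hΦ
    (hyΦ o) (hyΦ (β n)) (Nat.one_div_pos_of_nat (α := ℝ) (n := n))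
  choose l δ hl hlt h0 h1 hδΦ hlip using hcurve
  have hl_lim : Tendsto l atTop atTop := by
    have hβ' : Tendsto (fun n => dist (β n) o) atTop atTop := by
      simpa [β, o, Subtype.dist_eq] using tendsto_natCast_atTop_atTop (R := ℝ)
    refine tendsto_atTop_mono (fun n => ?_)
      (tendsto_dist_atTop hf o hβ' (fun n => hy (β n)) (y o))
    have h2 := hlip n (l n) ⟨hl n, le_rfl⟩ 0 ⟨le_rfl, hl n⟩
    rwa [h1, h0, sub_zero, abs_of_nonneg (hl n)] at h2
  exact exists_isometric_of_almost_geodesics (hK (y o)) δ (fun _ => 0) l (R := 0)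
    (fun n => ⟨le_rfl, hl n⟩)
    (fun t ht => (hl_lim.eventually_ge_atTop t).mono fun n hn => ⟨ht, hn⟩) hδΦ
    (fun n => by rw [h0, dist_self]) hlip (fun n => by rw [h0, h1, sub_zero]; exact hlt n)

end CubeComplex

theorem mainTheorem11 {V : Type*} (G : SimpleGraph V) [IsMedianGraph G]
    (hdim : CubeComplex.FiniteDimensional G) :
    (QuasiIsometric ℝ (CubeComplex G) → ∃ γ : ℝ → CubeComplex G, Isometry γ) ∧
    (QuasiIsometric (Set.Ici (0 : ℝ)) (CubeComplex G) →
      ∃ γ : Set.Ici (0 : ℝ) → CubeComplex G, Isometry γ) :=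
  ⟨CubeComplex.exists_isometry_real hdim, CubeComplex.exists_isometry_Ici hdim⟩
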